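/- Graphs are finite and may have parallel edges and loops; $d_G$ denotes distance in $G$. A graph is 2-connected if it has at least two vertices, is connected, and has no cut vertex and no bridge (so the circuit of length $2$ is 2-connected, while $K_2$ is not). For a 2-connected graph $G$ let $$l(G):=\min_{C}\ \max_{v\in V(G)} d_G(C,v),$$ where $C$ runs over all circuits of $G$. For a set $\mathcal S$ of 2-connected graphs let $l_m(\mathcal S):=\max_{G\in\mathcal S} l(G)$ if this maximum exists, and $l_m(\mathcal S):=\infty$ otherwise. A set $\mathcal S$ of graphs is an even subdivision-factor of a cubic graph $G$ if $G$ has a spanning subgraph $H$ such that every component of $H$ has an even number of vertices and is a subdivision of an element of $\mathcal S$. Let $P_{10}$ be the Petersen graph and let $P:=P_{10}-z$ for a vertex $z$. Put $P_{10}^0:=P_{10}$, and let $P_{10}^{k}$ be obtained from $P_{10}^{k-1}$ by replacing every vertex $v$ by a copy of $P$ whose three vertices of degree $2$ are joined, one each, to the three edges formerly incident with $v$. **Corollary.** Let $\mathcal S_0$ be a set of 2-connected graphs with $l_m(\mathcal S_0)\neq\infty$. Then there is an infinite set $\mathcal S$ of (pairwise non-isomorphic) 3-connected cubic graphs such that for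 every $G\in\mathcal S$ the set $\mathcal S_0$ is not an even subdivision-factor of $G$. More precisely, one can take $$\mathcal S=\{P_{10}^k \mid k\ge 2,\ 2^{2k-3}>l_m(\mathcal S_0)\}:$$ there are infinitely many such $k$, the graphs $P_{10}^k$ are pairwise non-isomorphic, and every $P_{10}^k\in\mathcal S$ is a finite 3-connected cubic graph of which $\mathcal S_0$ is not an even subdivision-factor. -/

import Mathlib

open scoped Graph

noncomputable section

namespace Graph

universe u v u' v'

variable {α : Type u} {β : Type v} {α' : Type u'} {β' : Type v'}

/-! ### Basic notions for multigraphs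

Graphs are Mathlib's multigraphs `Graph α β`: parallel edges and loops are allowed. -/

/-- The graph has finitely many vertices and finitely many edges. -/
def IsFiniteGraph (G : Graph α β) : Prop := V(G).Finite ∧ E(G).Finite

/-- The degree (valency) of a vertex; a loop counts twice. -/
def valency (G : Graph α β) (x : α) : ℕ∞ := (G.incidenceSet x).encard + (G.loopSet x).encard

/-- Every vertex has degree three. -/
def IsCubic (G : Graph α β) : Prop := ∀ x ∈ V(G), G.valency x = 3

/-- The graph has a vertex, and any two of its vertices are joined by a path. -/
def IsConnectedGraph (G : Graph α β) : Prop := G.toSimpleGraph.Connected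

/-- A multigraph is 2-connected if it has at least two vertices, is connected, and has neither a
cut vertex nor a bridge. (If there are at least three vertices the last condition is automatic;
on two vertices it says that there are at least two parallel edges, so that the circuit of length
two is 2-connected and `K₂` is not.) -/
def IsTwoConnected (G : Graph α β) : Prop :=
  V(G).Nontrivial ∧ G.IsConnectedGraph ∧
    (∀ x ∈ V(G), (G.deleteVerts {x}).IsConnectedGraph) ∧
    (∀ e ∈ E(G), (G.deleteEdges {e}).IsConnectedGraph)

/-- A graph is 3-connected if it has at least four vertices and deleting at most two vertices
always leaves a connected graph. -/
def IsThreeConnected (G : Graph α β) : Prop :=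
  4 ≤ V(G).encard ∧ ∀ X : Set α, X.encard ≤ 2 → (G.deleteVerts X).IsConnectedGraph

/-- A circuit: a finite connected graph in which every vertex has degree two. -/
def IsCircuit (C : Graph α β) : Prop :=
  C.IsFiniteGraph ∧ C.IsConnectedGraph ∧ ∀ x ∈ V(C), C.valency x = 2

/-- `K` is a (connected) component of `H`: a maximal connected subgraph. -/
def IsComponentOf (K H : Graph α β) : Prop :=
  Maximal (fun L : Graph α β => L ≤ H ∧ L.IsConnectedGraph) K

/-- Two graphs are isomorphic. -/
def IsIsomorphic (G : Graph α β) (H : Graph α' β') : Prop :=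
  ∃ (φ : V(G) ≃ V(H)) (ψ : E(G) ≃ E(H)), ∀ (e : E(G)) (x y : V(G)),
    G.IsLink e x y ↔ H.IsLink (ψ e) (φ x) (φ y)

/-! ### The parameters `l` and `l_m` -/

/-- The distance `d_G(C, x)` between a subgraph `C` of `G` and a vertex `x` of `G`: the minimal
number of edges of a path of `G` from a vertex of `C` to `x`. -/
def distTo (G C : Graph α β) (x : V(G)) : ℕ∞ :=
  ⨅ (y : V(G)) (_ : (y : α) ∈ V(C)), G.toSimpleGraph.edist y x

/-- `l(G)`: the minimum over all circuits `C` of `G` of the maximal distance of a vertex of `G`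
from `C`. -/
def hamDefect (G : Graph α β) : ℕ∞ :=
  ⨅ (C : Graph α β) (_ : C ≤ G ∧ C.IsCircuit), ⨆ x : V(G), G.distTo C x

open Classical in
/-- `l_m(S)`: the maximum of `l(G)` over all `G` in `S` if this maximum exists, and `∞`
otherwise. -/
def maxHamDefect (S : Set (Graph α β)) : ℕ∞ :=
  if ∃ m, IsGreatest (hamDefect '' S) m then sSup (hamDefect '' S) else ⊤

/-! ### Subdivisions and even subdivision-factors -/

/-- `H` arises from `G` by subdividing one edge `e = xy`: the edge `e` is deleted, and a new vertex
`w` is added together with two new edges, `e₁` from `x` to `w` and `e₂` from `w` to `y`. (The name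
`e` may be used again for one of the two new edges.) -/
def IsEdgeSubdivision (G H : Graph α β) : Prop :=
  ∃ (e e₁ e₂ : β) (x y w : α), G.IsLink e x y ∧ w ∉ V(G) ∧ e₁ ≠ e₂ ∧
    e₁ ∉ E(G) \ {e} ∧ e₂ ∉ E(G) \ {e} ∧
    V(H) = insert w V(G) ∧
    ∀ (f : β) (a b : α), H.IsLink f a b ↔
      (f ≠ e ∧ G.IsLink f a b) ∨ (f = e₁ ∧ s(a, b) = s(x, w)) ∨ (f = e₂ ∧ s(a, b) = s(w, y))

/-- `IsSubdivision F H`: the graph `H` is a subdivision of `F`, that is, it is obtained from an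
isomorphic copy of `F` by finitely many (possibly zero) edge subdivisions. -/
inductive IsSubdivision (F : Graph α β) : Graph α' β' → Prop
  | of_iso {H : Graph α' β'} : F.IsIsomorphic H → IsSubdivision F H
  | subdivide {H H' : Graph α' β'} :
      IsSubdivision F H → H.IsEdgeSubdivision H' → IsSubdivision F H'

/-- `S` is an even subdivision-factor of `G`: the graph `G` has a spanning subgraph `H` each of
whose components is a subdivision of an element of `S` and has an even number of vertices. -/
def IsEvenSubdivisionFactor (S : Set (Graph α β)) (G : Graph α' β') : Prop :=
  ∃ H : Graph α' β', H ≤ G ∧ V(H) = V(G) ∧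
    ∀ K : Graph α' β', K.IsComponentOf H →
      (∃ F ∈ S, F.IsSubdivision K) ∧ V(K).Finite ∧ Even V(K).ncard

/-! ### The iterated Petersen graphs

A simple cubic graph on a vertex type `V` whose edge ends at each vertex are numbered by `0, 1, 2`
is encoded by a map `r : V × Fin 3 → V × Fin 3`: the equation `r (x, i) = (y, j)` says that the
`i`-th edge at `x` is the `j`-th edge at `y`. -/

/-- The vertices of the Petersen graph: `(false, i)` on the outer pentagon, `(true, i)` on the
inner pentagram. -/
abbrev PetersenVertex : Type := Bool × ZMod 5

/-- The Petersen graph: the edges join `(false, i)` to `(false, i + 1)`, `(true, i)` to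
`(true, i + 2)`, and `(false, i)` to `(true, i)`. -/
def petersenRot : PetersenVertex × Fin 3 → PetersenVertex × Fin 3
  | ((false, i), 0) => ((false, i + 1), 1)
  | ((false, i), 1) => ((false, i - 1), 0)
  | ((false, i), 2) => ((true, i), 2)
  | ((true, i), 0) => ((true, i + 2), 1)
  | ((true, i), 1) => ((true, i - 2), 0)
  | ((true, i), 2) => ((false, i), 2)

/-- The vertex `z` deleted from the Petersen graph in order to obtain `P`. -/
def petersenRoot : PetersenVertex := (false, 0)

/-- The vertices of `P`, the Petersen graph minus the vertex `z`. The three 2-valent vertices of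
`P` are the neighbours `(petersenRot (z, j)).1` of `z`, for `j = 0, 1, 2`. -/
abbrev PVertex : Type := {p : PetersenVertex // p ≠ petersenRoot}

theorem petersenRot_root_ne (j : Fin 3) : (petersenRot (petersenRoot, j)).1 ≠ petersenRoot := by
  revert j
  unfold petersenRoot
  decide

/-- The `P`-inflation at every vertex. Each vertex `v` is replaced by the copy `{v} × P` of `P`,
and the `j`-th edge at `v` is attached to the `j`-th 2-valent vertex of that copy: thus, if this
edge is also the `j'`-th edge at `v'`, then the `j`-th 2-valent vertex of the copy `{v} × P`
becomes adjacent to the `j'`-th 2-valent vertex of the copy `{v'} × P`. An edge end of `P` which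
leads to `z` along the `j`-th edge at `z` is turned into an end of that new edge. -/
def inflateRot {V : Type} (r : V × Fin 3 → V × Fin 3) :
    (V × PVertex) × Fin 3 → (V × PVertex) × Fin 3 :=
  fun x =>
    let t := petersenRot (x.1.2.1, x.2)
    if h : t.1 = petersenRoot then
      let y := r (x.1.1, t.2)
      ((y.1, ⟨(petersenRot (petersenRoot, y.2)).1, petersenRot_root_ne y.2⟩),
        (petersenRot (petersenRoot, y.2)).2)
    else ((x.1.1, ⟨t.1, h⟩), t.2)

/-- The vertices of `P₁₀^k`. -/
def IterVertex : ℕ → Type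
  | 0 => PetersenVertex
  | k + 1 => IterVertex k × PVertex

/-- The edge structure of `P₁₀^k`: start with the Petersen graph, and apply `k` times the
`P`-inflation at every vertex. -/
def iterRot : (k : ℕ) → IterVertex k × Fin 3 → IterVertex k × Fin 3
  | 0 => petersenRot
  | k + 1 => inflateRot (iterRot k)

/-- The graph `P₁₀^k`: the Petersen graph for `k = 0`, the iterated Petersen graph for `k ≥ 1`. -/
def iteratedPetersen (k : ℕ) : Graph (IterVertex k) (Sym2 (IterVertex k)) :=
  Graph.ofSimpleGraph (SimpleGraph.fromRel fun x y => ∃ i, (iterRot k (x, i)).1 = y)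

end Graph

end

open scoped Graph

noncomputable section

namespace Graph

/-! ### Finite facts about the Petersen graph -/

/-! Let `H` be a spanning subgraph of `P₁₀^k` whose components are even and are subdivisions of
members of `S₀`. Then `H` has no bridge, and every odd vertex set is left by an edge of `H`, since
otherwise it would be a union of even components. This is `CutGood`. It survives contracting every
copy of `P` (nine vertices, an odd number), and also contracting everything outside one copy to the
root of a Petersen graph (`CutGood.contract`, `CutGood.local`).

In the Petersen graph `CutGood` forces connectedness, and an induction over the inflations shows
that `H` is connected (`CutGood.connected`). Hence `H` is a subdivision of a single `F ∈ S₀`.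
Subdividing does not change distances if only the old vertices on a walk are counted, so `H` has a
circuit from which every branch vertex (vertex of degree three in `H`) is reached by a walk with
fewer than `2 ^ (2 * k - 3)` branch vertices after its first vertex (`NearCircuit`).

This is impossible. A walk of `H` through a copy of `P` meets a branch vertex (`crossBound_one`):
otherwise `H` would induce a 2-factor of the Petersen graph, that is, two pentagons, and a pentagon
is an odd set left by no edge. The girth being five, a walk through a copy of `P` at the next level
passes through at least four parts, so every further inflation multiplies the cost of crossing by
four (`CrossBound.inflate`). Contract `P₁₀^k` to the Petersen graph. As that graph has no Hamilton
circuit, the given circuit misses one of the ten parts (`CircuitLike.exists_missed`). This part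
consists of nine subparts, each of crossing cost `4 ^ (k - 2)`. A subpart that does not touch the
boundary of the missed part contains a branch vertex whose distance from the circuit is at least
twice this cost, which is `2 ^ (2 * k - 3)` (`CutGood.exists_far_branch`). -/

theorem petersenRot_petersenRot : ∀ d, petersenRot (petersenRot d) = d := by decide

theorem petersenRot_fst_ne : ∀ d, (petersenRot d).1 ≠ d.1 := by decide

theorem petersenRot_fst_inj :
    ∀ x i j, (petersenRot (x, i)).1 = (petersenRot (x, j)).1 → i = j := by decide

/-- At least two of the three values agree with `b`. -/
def twoAgree (b x y z : Bool) : Bool :=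
  ((x == b) && (y == b)) || ((y == b) && (z == b)) || ((x == b) && (z == b))

set_option synthInstance.maxSize 1000 in
set_option synthInstance.maxHeartbeats 400000 in
theorem petersen_bisection_aux : ∀ a0 a1 a2 a3 a4 b0 b1 b2 b3 b4 : Bool,
    (twoAgree a0 a1 a4 b0 && (twoAgree a1 a2 a0 b1 && (twoAgree a2 a3 a1 b2 &&
      (twoAgree a3 a4 a2 b3 && (twoAgree a4 a0 a3 b4 && (twoAgree b0 b2 b3 a0 &&
      (twoAgree b1 b3 b4 a1 && (twoAgree b2 b4 b0 a2 && (twoAgree b3 b0 b1 a3 &&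
      twoAgree b4 b1 b2 a4))))))))) = true →
    (a0 ^^ a1 ^^ a2 ^^ a3 ^^ a4 ^^ b0 ^^ b1 ^^ b2 ^^ b3 ^^ b4) = false →
    a1 = a0 ∧ a2 = a0 ∧ a3 = a0 ∧ a4 = a0 ∧ b0 = a0 ∧ b1 = a0 ∧ b2 = a0 ∧ b3 = a0 ∧ b4 = a0 := by
  decide

theorem forall_petersenVertex {p : PetersenVertex → Prop} :
    (∀ x, p x) ↔ (p (false, 0) ∧ p (false, 1) ∧ p (false, 2) ∧ p (false, 3) ∧ p (false, 4)) ∧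
      (p (true, 0) ∧ p (true, 1) ∧ p (true, 2) ∧ p (true, 3) ∧ p (true, 4)) := by
  constructor
  · intro h; simp [h]
  · rintro ⟨⟨_, _, _, _, _⟩, ⟨_, _, _, _, _⟩⟩ ⟨b, i⟩
    cases b <;> fin_cases i <;> assumption

theorem twoAgree_of_exists (f : PetersenVertex → Bool) (x : PetersenVertex)
    (h : ∃ i j, i ≠ j ∧ f (petersenRot (x, i)).1 = f x ∧ f (petersenRot (x, j)).1 = f x) :
    twoAgree (f x) (f (petersenRot (x, 0)).1) (f (petersenRot (x, 1)).1)
      (f (petersenRot (x, 2)).1) = true := by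
  obtain ⟨i, j, hij, hi, hj⟩ := h
  unfold twoAgree
  fin_cases i <;> fin_cases j <;> simp_all

/-- If both sides were nonempty, each would induce minimum degree at least two and hence contain a
circuit. The girth is five, so both sides would have exactly five vertices, against parity. The
check itself runs through all colourings. -/
theorem petersen_bisection (S : Set PetersenVertex) (hS : Even S.ncard)
    (h : ∀ x, ∃ i j, i ≠ j ∧ ((petersenRot (x, i)).1 ∈ S ↔ x ∈ S) ∧
      ((petersenRot (x, j)).1 ∈ S ↔ x ∈ S)) : S = ∅ ∨ S = Set.univ := by
  classical
  set f : PetersenVertex → Bool := fun x => decide (x ∈ S) with hf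
  have h2 : ∀ x, twoAgree (f x) (f (petersenRot (x, 0)).1) (f (petersenRot (x, 1)).1)
      (f (petersenRot (x, 2)).1) = true := by
    intro x
    apply twoAgree_of_exists
    obtain ⟨i, j, hij, hi, hj⟩ := h x
    exact ⟨i, j, hij, by simp [hf, hi], by simp [hf, hj]⟩
  have hc : S.ncard = ∑ x : PetersenVertex, (f x).toNat := by
    have hS' : S = (Finset.univ.filter (· ∈ S) : Finset PetersenVertex) := by ext; simp
    calc S.ncard = (Finset.univ.filter (· ∈ S)).card := by
          conv_lhs => rw [hS', Set.ncard_coe_finset]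
      _ = _ := by
          rw [Finset.card_filter]
          exact Finset.sum_congr rfl fun x _ => by by_cases hx : x ∈ S <;> simp [hf, hx]
  rw [hc, Fintype.sum_prod_type] at hS
  have h5 : ∀ g : ZMod 5 → ℕ, ∑ i, g i = g 0 + g 1 + g 2 + g 3 + g 4 := fun g => Fin.sum_univ_five g
  simp only [h5, Fintype.sum_bool] at hS
  rw [forall_petersenVertex] at h2
  have := petersen_bisection_aux (f (false, 0)) (f (false, 1)) (f (false, 2)) (f (false, 3))
    (f (false, 4)) (f (true, 0)) (f (true, 1)) (f (true, 2)) (f (true, 3)) (f (true, 4))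
    (by
      obtain ⟨⟨a0, a1, a2, a3, a4⟩, ⟨b0, b1, b2, b3, b4⟩⟩ := h2
      simp only [Bool.and_eq_true]
      exact ⟨a0, a1, a2, a3, a4, b0, b1, b2, b3, b4⟩)
    (by
      -- The parity of a sum of ten bits is their exclusive or.
      clear h2 hc h
      generalize f (false, 0) = a0 at *; generalize f (false, 1) = a1 at *
      generalize f (false, 2) = a2 at *; generalize f (false, 3) = a3 at *
      generalize f (false, 4) = a4 at *; generalize f (true, 0) = b0 at *
      generalize f (true, 1) = b1 at *; generalize f (true, 2) = b2 at *
      generalize f (true, 3) = b3 at *; generalize f (true, 4) = b4 at *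
      clear hf f
      revert a0 a1 a2 a3 a4 b0 b1 b2 b3 b4
      decide)
  have hall : ∀ x, f x = f (false, 0) := by
    rw [forall_petersenVertex]
    tauto
  by_cases h0 : (false, 0) ∈ S
  · right; ext x; have := hall x; simp_all
  · left; ext x; have := hall x; simp_all

/-- The edge set of the Petersen graph given by its outer edges `o`, its spokes `s`, and its
inner edges `t`. -/
def petersenEdges (o s t : ZMod 5 → Bool) : PetersenVertex × Fin 3 → Bool
  | ((false, i), 0) => o i
  | ((false, i), 1) => o (i - 1)
  | ((false, i), 2) => s i
  | ((true, i), 0) => t i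
  | ((true, i), 1) => t (i - 2)
  | ((true, i), 2) => s i

/-- The pentagons of the Petersen graph that avoid the root. -/
def petersenPentagons : List (List PetersenVertex) :=
  [[(true, 0), (true, 1), (true, 2), (true, 3), (true, 4)],
   [(false, 1), (false, 2), (false, 3), (true, 3), (true, 1)],
   [(false, 2), (false, 3), (false, 4), (true, 4), (true, 2)],
   [(false, 1), (false, 2), (true, 2), (true, 4), (true, 1)],
   [(false, 2), (false, 3), (true, 3), (true, 0), (true, 2)],
   [(false, 3), (false, 4), (true, 4), (true, 1), (true, 3)]]

/-- Exactly two of the three values hold. -/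
def exactlyTwo (x y z : Bool) : Bool := (x && y && !z) || (x && !y && z) || (!x && y && z)

/-- No edge of `h` leaves `S`. -/
def closedUnder (h : PetersenVertex × Fin 3 → Bool) (S : List PetersenVertex) : Bool :=
  S.all fun x => [0, 1, 2].all fun i => !h (x, i) || S.elem (petersenRot (x, i)).1

set_option synthInstance.maxSize 1000 in
set_option synthInstance.maxHeartbeats 400000 in
theorem petersen_two_factor_aux : ∀ o0 o1 o2 o3 o4 t0 t1 t2 t3 t4 : Bool,
    let o : ZMod 5 → Bool := (![o0, o1, o2, o3, o4] : Fin 5 → Bool)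
    let t : ZMod 5 → Bool := (![t0, t1, t2, t3, t4] : Fin 5 → Bool)
    let s : ZMod 5 → Bool := fun i => !(o i && o (i - 1))
    ([0, 1, 2, 3, 4].all fun i : ZMod 5 => exactlyTwo (o i) (o (i - 1)) (s i) &&
      exactlyTwo (t i) (t (i - 2)) (s i)) = true →
    (petersenPentagons.any fun S => closedUnder (petersenEdges o s t) S) = true := by
  decide +kernel

theorem petersenPentagons_spec : ∀ S ∈ petersenPentagons,
    S.Nodup ∧ S.length = 5 ∧ petersenRoot ∉ S := by
  unfold petersenRoot
  decide

/-- The Petersen graph has no Hamilton circuit and has girth five, so a 2-factor consists of two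
pentagons, one of which avoids the root. -/
theorem petersen_two_factor (h : PetersenVertex × Fin 3 → Prop)
    (hs : ∀ d, h (petersenRot d) ↔ h d)
    (h2 : ∀ x, ∃ i, ∀ j, h (x, j) ↔ j ≠ i) :
    ∃ S : Set PetersenVertex, Odd S.ncard ∧ petersenRoot ∉ S ∧
      ∀ d, h d → d.1 ∈ S → (petersenRot d).1 ∈ S := by
  classical
  set g : PetersenVertex × Fin 3 → Bool := fun d => decide (h d) with hg
  have hgs : ∀ d, g (petersenRot d) = g d := fun d => by simp [hg, hs]
  have hg2 : ∀ x, exactlyTwo (g (x, 0)) (g (x, 1)) (g (x, 2)) = true := by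
    intro x
    obtain ⟨i, hi⟩ := h2 x
    simp only [hg, hi]
    fin_cases i <;> simp [exactlyTwo]
  have h1 : ∀ i, g ((false, i), 1) = g ((false, i - 1), 0) := fun i => (hgs ((false, i), 1)).symm
  have h2' : ∀ i, g ((true, i), 1) = g ((true, i - 2), 0) := fun i => (hgs ((true, i), 1)).symm
  have h3 : ∀ i, g ((true, i), 2) = g ((false, i), 2) := fun i => (hgs ((true, i), 2)).symm
  have hfun : ∀ f : ZMod 5 → Bool, (![f 0, f 1, f 2, f 3, f 4] : Fin 5 → Bool) = f := by
    intro f; ext i; fin_cases i <;> rfl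
  -- Exactly two edges are present at each outer vertex, so the outer edges determine the spokes.
  -- Only ten bits remain for the exhaustive check.
  have hsp : ∀ i, g ((false, i), 2) = !(g ((false, i), 0) && g ((false, i - 1), 0)) := by
    intro i
    have := hg2 (false, i)
    rw [h1] at this
    revert this
    generalize g ((false, i), 0) = a, g ((false, i - 1), 0) = b, g ((false, i), 2) = c
    revert a b c; decide
  have key := petersen_two_factor_aux (g ((false, 0), 0)) (g ((false, 1), 0)) (g ((false, 2), 0))
    (g ((false, 3), 0)) (g ((false, 4), 0)) (g ((true, 0), 0)) (g ((true, 1), 0))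
    (g ((true, 2), 0)) (g ((true, 3), 0)) (g ((true, 4), 0))
  have e1 := hfun (fun i => g ((false, i), 0))
  have e2 := hfun (fun i => g ((true, i), 0))
  simp only [e1, e2, ← hsp] at key
  have hedge : petersenEdges (fun i => g ((false, i), 0)) (fun i => g ((false, i), 2))
      (fun i => g ((true, i), 0)) = g := by
    funext ⟨⟨b, i⟩, j⟩
    cases b <;> fin_cases j <;> simp [petersenEdges, h1, h2', h3]
  rw [hedge] at key
  have hpre : ([0, 1, 2, 3, 4].all fun i : ZMod 5 =>
      exactlyTwo (g ((false, i), 0)) (g ((false, i - 1), 0)) (g ((false, i), 2)) &&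
      exactlyTwo (g ((true, i), 0)) (g ((true, i - 2), 0)) (g ((false, i), 2))) = true := by
    rw [List.all_eq_true]
    intro i _
    rw [Bool.and_eq_true]
    refine ⟨?_, ?_⟩
    · rw [← h1]; exact hg2 _
    · rw [← h2', ← h3]; exact hg2 _
  have := key hpre
  rw [List.any_eq_true] at this
  obtain ⟨S, hS, hcl⟩ := this
  obtain ⟨hnd, hlen, hroot⟩ := petersenPentagons_spec S hS
  refine ⟨{x | x ∈ S}, ?_, hroot, ?_⟩
  · have : {x | x ∈ S} = (S.toFinset : Set PetersenVertex) := by ext; simp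
    rw [this, Set.ncard_coe_finset, List.toFinset_card_of_nodup hnd, hlen]
    decide
  · rintro ⟨x, i⟩ hd hx
    unfold closedUnder at hcl
    rw [List.all_eq_true] at hcl
    have h4 := hcl x hx
    rw [List.all_eq_true] at h4
    have h5 := h4 i (by fin_cases i <;> simp)
    have h6 : g (x, i) = true := by simpa [hg] using hd
    rw [h6] at h5
    simpa using h5

/-! ### Cuts -/

section Cuts

variable {V : Type} {r : V × Fin 3 → V × Fin 3} {h : V × Fin 3 → Prop}

/-- The edge end `d` belongs to `h`, lies in `T`, and its edge leaves `T`. -/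
def Crosses (r : V × Fin 3 → V × Fin 3) (h : V × Fin 3 → Prop) (T : Set V) (d : V × Fin 3) :
    Prop :=
  h d ∧ d.1 ∈ T ∧ (r d).1 ∉ T

/-- The set `h` of edges has no bridge, and every odd vertex set is left by an edge of `h`. -/
structure CutGood (r : V × Fin 3 → V × Fin 3) (h : V × Fin 3 → Prop) : Prop where
  symm : ∀ d, h (r d) ↔ h d
  two : ∀ T d, Crosses r h T d → ∃ d', d' ≠ d ∧ Crosses r h T d'
  odd : ∀ T : Set V, Odd T.ncard → ∃ d, Crosses r h T d

/-- The rotation of a simple cubic graph. -/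
structure IsRot (r : V × Fin 3 → V × Fin 3) : Prop where
  invol : ∀ d, r (r d) = d
  loopless : ∀ d, (r d).1 ≠ d.1
  simple : ∀ x i j, (r (x, i)).1 = (r (x, j)).1 → i = j

theorem isRot_petersenRot : IsRot petersenRot :=
  ⟨petersenRot_petersenRot, petersenRot_fst_ne, petersenRot_fst_inj⟩

/-- The edge end of the inflated graph that corresponds to an edge end of the original one. -/
def inflateEnd (d : V × Fin 3) : (V × PVertex) × Fin 3 :=
  ((d.1, ⟨(petersenRot (petersenRoot, d.2)).1, petersenRot_root_ne d.2⟩),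
    (petersenRot (petersenRoot, d.2)).2)

@[simp] theorem inflateEnd_fst_fst (d : V × Fin 3) : (inflateEnd d).1.1 = d.1 := rfl

theorem inflateEnd_injective : Function.Injective (inflateEnd : V × Fin 3 → _) := by
  rintro ⟨v, i⟩ ⟨w, j⟩ hd
  simp only [inflateEnd, Prod.mk.injEq, Subtype.mk.injEq] at hd
  obtain ⟨⟨rfl, h1⟩, h2⟩ := hd
  rw [isRot_petersenRot.simple _ _ _ h1]

theorem inflateRot_of_eq_root (v : V) (p : PVertex) (i : Fin 3)
    (hp : (petersenRot (p.1, i)).1 = petersenRoot) :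
    inflateRot r ((v, p), i) = inflateEnd (r (v, (petersenRot (p.1, i)).2)) := by
  simp [inflateRot, hp, inflateEnd]

theorem inflateRot_of_ne_root (v : V) (p : PVertex) (i : Fin 3)
    (hp : (petersenRot (p.1, i)).1 ≠ petersenRoot) :
    inflateRot r ((v, p), i) = ((v, ⟨_, hp⟩), (petersenRot (p.1, i)).2) := by
  simp [inflateRot, hp]

theorem eq_inflateEnd (v : V) (p : PVertex) (i : Fin 3)
    (hp : (petersenRot (p.1, i)).1 = petersenRoot) :
    ((v, p), i) = inflateEnd (v, (petersenRot (p.1, i)).2) := by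
  have h1 : petersenRot (petersenRoot, (petersenRot (p.1, i)).2) = (p.1, i) := by
    have : (petersenRoot, (petersenRot (p.1, i)).2) = petersenRot (p.1, i) :=
      Prod.ext hp.symm rfl
    rw [this, petersenRot_petersenRot]
  simp [inflateEnd, h1]

theorem inflateRot_inflateEnd (d : V × Fin 3) :
    inflateRot r (inflateEnd d) = inflateEnd (r d) := by
  unfold inflateEnd
  rw [inflateRot_of_eq_root]
  · simp [petersenRot_petersenRot, inflateEnd]
  · simp [petersenRot_petersenRot]

/-- An edge of the inflated graph either stays within a copy of `P` or is an original edge. -/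
theorem inflateRot_cases (x : (V × PVertex) × Fin 3) :
    (inflateRot r x).1.1 = x.1.1 ∧ (petersenRot (x.1.2.1, x.2)).1 = (inflateRot r x).1.2.1 ∧
      (petersenRot (x.1.2.1, x.2)).2 = (inflateRot r x).2 ∨
    ∃ d, x = inflateEnd d := by
  obtain ⟨⟨v, p⟩, i⟩ := x
  by_cases hp : (petersenRot (p.1, i)).1 = petersenRoot
  · exact Or.inr ⟨_, eq_inflateEnd v p i hp⟩
  · left; rw [inflateRot_of_ne_root _ _ _ hp]; simp

theorem IsRot.inflate (hr : IsRot r) : IsRot (inflateRot r) where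
  invol x := by
    obtain ⟨⟨v, p⟩, i⟩ := x
    by_cases hp : (petersenRot (p.1, i)).1 = petersenRoot
    · rw [eq_inflateEnd v p i hp, inflateRot_inflateEnd, inflateRot_inflateEnd, hr.invol]
    · rw [inflateRot_of_ne_root _ _ _ hp, inflateRot_of_ne_root]
      · simp [petersenRot_petersenRot]
      · simpa [petersenRot_petersenRot] using p.2
  loopless x := by
    obtain ⟨⟨v, p⟩, i⟩ := x
    by_cases hp : (petersenRot (p.1, i)).1 = petersenRoot
    · rw [inflateRot_of_eq_root _ _ _ hp]
      intro h
      exact hr.loopless (v, _) (show (r (v, _)).1 = v from congrArg Prod.fst h)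
    · rw [inflateRot_of_ne_root _ _ _ hp]
      intro h
      exact petersenRot_fst_ne (p.1, i) (congrArg Subtype.val (congrArg Prod.snd h))
  simple x i j hij := by
    obtain ⟨v, p⟩ := x
    by_cases hp : (petersenRot (p.1, i)).1 = petersenRoot <;>
    by_cases hq : (petersenRot (p.1, j)).1 = petersenRoot
    · exact petersenRot_fst_inj p.1 i j (hp.trans hq.symm)
    · rw [inflateRot_of_eq_root _ _ _ hp, inflateRot_of_ne_root _ _ _ hq] at hij
      exact absurd (congrArg Prod.fst hij) (hr.loopless _)
    · rw [inflateRot_of_ne_root _ _ _ hp, inflateRot_of_eq_root _ _ _ hq] at hij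
      exact absurd (congrArg Prod.fst hij).symm (hr.loopless _)
    · rw [inflateRot_of_ne_root _ _ _ hp, inflateRot_of_ne_root _ _ _ hq] at hij
      exact petersenRot_fst_inj p.1 i j (congrArg Subtype.val (congrArg Prod.snd hij))

theorem isRot_iterRot : ∀ k, IsRot (iterRot k)
  | 0 => isRot_petersenRot
  | k + 1 => (isRot_iterRot k).inflate

theorem crosses_inflateEnd {h : (V × PVertex) × Fin 3 → Prop} (T : Set V) (d : V × Fin 3) :
    Crosses (inflateRot r) h (Prod.fst ⁻¹' T) (inflateEnd d) ↔
      Crosses r (fun d => h (inflateEnd d)) T d := by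
  simp [Crosses, inflateRot_inflateEnd]

theorem exists_crosses_of_preimage {h : (V × PVertex) × Fin 3 → Prop} {T : Set V}
    {x : (V × PVertex) × Fin 3} (hx : Crosses (inflateRot r) h (Prod.fst ⁻¹' T) x) :
    ∃ d, x = inflateEnd d ∧ Crosses r (fun d => h (inflateEnd d)) T d := by
  rcases inflateRot_cases (r := r) x with h1 | ⟨d, rfl⟩
  · exact absurd hx.2.1 (by simpa [← h1.1] using hx.2.2)
  · exact ⟨d, rfl, (crosses_inflateEnd T d).1 hx⟩

theorem card_pVertex : Nat.card PVertex = 9 := by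
  rw [Nat.card_eq_fintype_card]; unfold PVertex petersenRoot; decide

theorem ncard_preimage_fst (T : Set V) :
    ((Prod.fst : V × PVertex → V) ⁻¹' T).ncard = T.ncard * 9 := by
  rw [← Set.prod_univ, Set.ncard_prod, Set.ncard_univ, card_pVertex]

/-- The cut of a vertex set downstairs is the cut of its preimage, and the preimage has nine times
as many vertices, so odd sets stay odd. -/
theorem CutGood.contract {h : (V × PVertex) × Fin 3 → Prop} (hc : CutGood (inflateRot r) h) :
    CutGood r (fun d => h (inflateEnd d)) where
  symm d := by rw [← inflateRot_inflateEnd, hc.symm]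
  two T d hd := by
    obtain ⟨d', hne, hd'⟩ := hc.two _ _ ((crosses_inflateEnd T d).2 hd)
    obtain ⟨d'', rfl, h2⟩ := exists_crosses_of_preimage hd'
    exact ⟨d'', fun h => hne (h ▸ rfl), h2⟩
  odd T hT := by
    obtain ⟨d, hd⟩ := hc.odd (Prod.fst ⁻¹' T) (by
      rw [ncard_preimage_fst]; exact hT.mul (by decide))
    obtain ⟨d'', rfl, h2⟩ := exists_crosses_of_preimage hd
    exact ⟨d'', h2⟩

/-- The edge end of the inflated graph that an edge end of the Petersen graph stands for within
the copy of `P` at `v`; the edges at the root stand for the edges that leave this copy. -/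
def localEnd (v : V) (d : PetersenVertex × Fin 3) : (V × PVertex) × Fin 3 :=
  if hd : d.1 = petersenRoot then inflateEnd (v, d.2) else ((v, ⟨d.1, hd⟩), d.2)

theorem localEnd_root (v : V) (j : Fin 3) : localEnd v (petersenRoot, j) = inflateEnd (v, j) := by
  simp [localEnd]

theorem localEnd_of_ne (v : V) (p : PVertex) (j : Fin 3) :
    localEnd v (p.1, j) = ((v, p), j) := by
  simp [localEnd, p.2]

theorem localEnd_symm {h : (V × PVertex) × Fin 3 → Prop}
    (hs : ∀ d, h (inflateRot r d) ↔ h d) (v : V) (d : PetersenVertex × Fin 3) :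
    h (localEnd v (petersenRot d)) ↔ h (localEnd v d) := by
  obtain ⟨p, i⟩ := d
  by_cases hp : p = petersenRoot
  · subst hp
    rw [localEnd_root]
    have := localEnd_of_ne v ⟨_, petersenRot_root_ne i⟩ (petersenRot (petersenRoot, i)).2
    rw [show petersenRot (petersenRoot, i) = ((petersenRot (petersenRoot, i)).1,
      (petersenRot (petersenRoot, i)).2) from rfl, this]
    rfl
  · have h1 := localEnd_of_ne v ⟨p, hp⟩ i
    rw [h1]
    by_cases hq : (petersenRot (p, i)).1 = petersenRoot
    · rw [eq_inflateEnd v ⟨p, hp⟩ i hq, ← localEnd_root]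
      have : (petersenRoot, (petersenRot (p, i)).2) = petersenRot (p, i) := Prod.ext hq.symm rfl
      rw [this]
    · rw [← hs ((v, ⟨p, hp⟩), i), inflateRot_of_ne_root v ⟨p, hp⟩ i hq,
        ← localEnd_of_ne v ⟨(petersenRot (p, i)).1, hq⟩]

theorem crosses_compl (hi : ∀ d, r (r d) = d) (hs : ∀ d, h (r d) ↔ h d) (T : Set V)
    (d : V × Fin 3) : Crosses r h Tᶜ (r d) ↔ Crosses r h T d := by
  simp [Crosses, hs, hi, and_comm]

theorem crosses_local {h : (V × PVertex) × Fin 3 → Prop} (hr : IsRot r) (v : V)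
    {T : Set PetersenVertex} (hT : petersenRoot ∉ T) (p : PVertex) (i : Fin 3) :
    Crosses (inflateRot r) h {x | x.1 = v ∧ x.2.1 ∈ T} ((v, p), i) ↔
      Crosses petersenRot (fun d => h (localEnd v d)) T (p.1, i) := by
  unfold Crosses
  dsimp only
  rw [localEnd_of_ne]
  by_cases hq : (petersenRot (p.1, i)).1 = petersenRoot
  · rw [inflateRot_of_eq_root _ _ _ hq, hq]
    simp [hr.loopless (v, _), hT]
  · rw [inflateRot_of_ne_root _ _ _ hq]
    simp

/-- A set and its complement have the same cut, and they have the same parity because there are ten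
vertices. So it suffices to treat the side without the root. -/
theorem cutGood_of_root_notMem {h : PetersenVertex × Fin 3 → Prop}
    (symm : ∀ d, h (petersenRot d) ↔ h d)
    (two : ∀ T, petersenRoot ∉ T → ∀ d, Crosses petersenRot h T d →
      ∃ d', d' ≠ d ∧ Crosses petersenRot h T d')
    (odd : ∀ T : Set PetersenVertex, petersenRoot ∉ T → Odd T.ncard →
      ∃ d, Crosses petersenRot h T d) : CutGood petersenRot h where
  symm := symm
  two T d hd := by
    by_cases hT : petersenRoot ∈ T
    · obtain ⟨d', hne, hd'⟩ := two Tᶜ (by simpa using hT) (petersenRot d)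
        ((crosses_compl petersenRot_petersenRot symm T d).2 hd)
      refine ⟨petersenRot d', fun h => hne ?_, ?_⟩
      · rw [← h, petersenRot_petersenRot]
      · rwa [← crosses_compl petersenRot_petersenRot symm, petersenRot_petersenRot]
    · exact two T hT d hd
  odd T hodd := by
    by_cases hT : petersenRoot ∈ T
    · obtain ⟨d, hd⟩ := odd Tᶜ (by simpa using hT) (by
        have h1 := Set.ncard_add_ncard_compl T
        have h2 : Nat.card PetersenVertex = 10 := by
          rw [Nat.card_eq_fintype_card]; decide
        rw [h2] at h1
        rcases Nat.even_or_odd Tᶜ.ncard with h3 | h3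
        · exact absurd (h1 ▸ hodd.add_even h3) (by decide)
        · exact h3)
      exact ⟨petersenRot d, by
        rwa [← crosses_compl petersenRot_petersenRot symm, petersenRot_petersenRot]⟩
    · exact odd T hT hodd

/-- A set of Petersen vertices avoiding the root is a set of vertices of the copy at `v`, with the
same size and the same cut. The edges to the root play the role of the edges that leave the copy. -/
theorem CutGood.local {h : (V × PVertex) × Fin 3 → Prop} (hr : IsRot r)
    (hc : CutGood (inflateRot r) h) (v : V) :
    CutGood petersenRot (fun d => h (localEnd v d)) := by
  have hpull : ∀ T : Set PetersenVertex, petersenRoot ∉ T → ∀ x,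
      Crosses (inflateRot r) h {x | x.1 = v ∧ x.2.1 ∈ T} x →
        x = ((v, x.1.2), x.2) ∧
        Crosses petersenRot (fun d => h (localEnd v d)) T (x.1.2.1, x.2) := by
    rintro T hT ⟨⟨w, p⟩, i⟩ hx
    obtain rfl : w = v := hx.2.1.1
    exact ⟨rfl, (crosses_local hr w hT p i).1 hx⟩
  apply cutGood_of_root_notMem
  · exact localEnd_symm hc.symm v
  · rintro T hT ⟨p, i⟩ hd
    have hp : p ≠ petersenRoot := fun h => hT (h ▸ hd.2.1)
    obtain ⟨d', hne, hd'⟩ := hc.two _ _ ((crosses_local hr v hT ⟨p, hp⟩ i).2 hd)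
    obtain ⟨h1, h2⟩ := hpull T hT d' hd'
    refine ⟨_, fun h => hne ?_, h2⟩
    rw [h1]
    simp only [Prod.mk.injEq] at h
    simp [← h.1, h.2]
  · intro T hT hodd
    have hcard : ({x : V × PVertex | x.1 = v ∧ x.2.1 ∈ T}).ncard = T.ncard := by
      symm
      apply Set.ncard_congr (fun p hp => (v, ⟨p, fun h => hT (h ▸ hp)⟩))
      · intro a ha; exact ⟨rfl, ha⟩
      · intro a b ha hb hab; simpa using hab
      · rintro ⟨w, p⟩ ⟨rfl, hp⟩; exact ⟨p.1, hp, rfl⟩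
    obtain ⟨d, hd⟩ := hc.odd _ (hcard ▸ hodd)
    exact ⟨_, (hpull T hT d hd).2⟩

/-- No edge of `h` joins `T` to its complement. -/
def IsClosedFor (r : V × Fin 3 → V × Fin 3) (h : V × Fin 3 → Prop) (T : Set V) : Prop :=
  ∀ d, h d → (d.1 ∈ T ↔ (r d).1 ∈ T)

theorem isClosedFor_iff (hi : ∀ d, r (r d) = d) (hs : ∀ d, h (r d) ↔ h d) (T : Set V) :
    IsClosedFor r h T ↔ ∀ d, ¬ Crosses r h T d := by
  constructor
  · rintro hT d ⟨h1, h2, h3⟩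
    exact h3 ((hT d h1).1 h2)
  · intro hT d hd
    by_contra hcon
    by_cases h1 : d.1 ∈ T
    · exact hT d ⟨hd, h1, fun h2 => hcon (by tauto)⟩
    · refine hT (r d) ⟨(hs d).2 hd, by tauto, ?_⟩
      rwa [hi]

/-- Every vertex lies on two edges of `h`. -/
theorem CutGood.exists_two (hc : CutGood r h) (x : V) :
    ∃ i j, i ≠ j ∧ h (x, i) ∧ h (x, j) := by
  obtain ⟨⟨y, i⟩, hi⟩ := hc.odd {x} (by simp)
  obtain rfl : y = x := hi.2.1
  obtain ⟨⟨z, j⟩, hne, hj⟩ := hc.two _ _ hi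
  obtain rfl : z = y := hj.2.1
  exact ⟨i, j, fun h => hne (h ▸ rfl), hi.1, hj.1⟩

/-- A closed set is even, and each vertex has at least two neighbours along `h`, all on its own
side, so `petersen_bisection` applies. -/
theorem CutGood.petersen_connected {h : PetersenVertex × Fin 3 → Prop}
    (hc : CutGood petersenRot h) {T : Set PetersenVertex} (hT : IsClosedFor petersenRot h T) :
    T = ∅ ∨ T = Set.univ := by
  apply petersen_bisection
  · by_contra hcon
    obtain ⟨d, hd⟩ := hc.odd T (Nat.not_even_iff_odd.1 hcon)
    exact hd.2.2 ((hT d hd.1).1 hd.2.1)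
  · intro x
    obtain ⟨i, j, hij, hi, hj⟩ := hc.exists_two x
    exact ⟨i, j, hij, (hT _ hi).symm, (hT _ hj).symm⟩

end Cuts

/-! ### Bridgeless subgraphs of the Petersen graph without closed odd sets -/

section Petersen

variable {h : PetersenVertex × Fin 3 → Prop}

theorem CutGood.closed_of_forall_not_crosses (hc : CutGood petersenRot h)
    {T : Set PetersenVertex} (hT : ∀ d, ¬ Crosses petersenRot h T d) : T = ∅ ∨ T = Set.univ :=
  hc.petersen_connected ((isClosedFor_iff petersenRot_petersenRot hc.symm T).2 hT)

theorem petersen_eq_of_fst_eq_root {d d' : PetersenVertex × Fin 3}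
    (h1 : (petersenRot d).1 = petersenRoot) (h2 : (petersenRot d').1 = petersenRoot)
    (h3 : (petersenRot d).2 = (petersenRot d').2) : d = d' := by
  rw [← petersenRot_petersenRot d, ← petersenRot_petersenRot d']
  exact congrArg _ (Prod.ext (h1.trans h2.symm) h3)

/-- The Petersen graph minus its root is connected along `h`. -/
theorem CutGood.petersen_sub_root (hc : CutGood petersenRot h) {T : Set PetersenVertex}
    (hroot : petersenRoot ∉ T)
    (hT : ∀ d, h d → d.1 ≠ petersenRoot → (petersenRot d).1 ≠ petersenRoot →
      d.1 ∈ T → (petersenRot d).1 ∈ T) : T = ∅ ∨ T = {petersenRoot}ᶜ := by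
  by_cases hcr : ∃ d, Crosses petersenRot h T d
  swap
  · left
    rcases hc.closed_of_forall_not_crosses (not_exists.1 hcr) with h1 | h1
    · exact h1
    · exact absurd (h1 ▸ Set.mem_univ _) hroot
  right
  -- Edges leaving `T` or `R` can only go to the root. Without bridges each of the two sets would
  -- send at least two edges there, but the root has only three.
  set R := (insert petersenRoot T)ᶜ with hR
  have hmemR : ∀ x, x ∈ R ↔ x ≠ petersenRoot ∧ x ∉ T := by intro x; simp [hR]
  have toRootT : ∀ d, Crosses petersenRot h T d → (petersenRot d).1 = petersenRoot := by
    intro d hd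
    by_contra hne
    exact hd.2.2 (hT d hd.1 (fun h => hroot (h ▸ hd.2.1)) hne hd.2.1)
  have toRootR : ∀ d, Crosses petersenRot h R d → (petersenRot d).1 = petersenRoot := by
    intro d hd
    by_contra hne
    have h1 := (hmemR _).1 hd.2.1
    have h2 : (petersenRot d).1 ∈ T := by
      by_contra h2
      exact hd.2.2 ((hmemR _).2 ⟨hne, h2⟩)
    have := hT (petersenRot d) ((hc.symm d).2 hd.1) hne
    rw [petersenRot_petersenRot] at this
    exact h1.2 (this h1.1 h2)
  by_cases hcrR : ∃ d, Crosses petersenRot h R d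
  · exfalso
    obtain ⟨d1, h1⟩ := hcr
    obtain ⟨d2, hne, h2⟩ := hc.two _ _ h1
    obtain ⟨d3, h3⟩ := hcrR
    obtain ⟨d4, hne', h4⟩ := hc.two _ _ h3
    have key : ∀ d d', Crosses petersenRot h T d → Crosses petersenRot h R d' →
        (petersenRot d).2 ≠ (petersenRot d').2 := by
      intro d d' hd hd' heq
      have := petersen_eq_of_fst_eq_root (toRootT d hd) (toRootR d' hd') heq
      subst this
      exact ((hmemR _).1 hd'.2.1).2 hd.2.1
    have k12 : (petersenRot d2).2 ≠ (petersenRot d1).2 := fun heq =>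
      hne (petersen_eq_of_fst_eq_root (toRootT d2 h2) (toRootT d1 h1) heq)
    have k34 : (petersenRot d4).2 ≠ (petersenRot d3).2 := fun heq =>
      hne' (petersen_eq_of_fst_eq_root (toRootR d4 h4) (toRootR d3 h3) heq)
    have k13 := key _ _ h1 h3
    have k14 := key _ _ h1 h4
    have k23 := key _ _ h2 h3
    have k24 := key _ _ h2 h4
    omega
  · rcases hc.closed_of_forall_not_crosses (not_exists.1 hcrR) with h1 | h1
    · ext x
      have h2 : x ∉ R := h1 ▸ Set.notMem_empty x
      rw [hmemR] at h2
      constructor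
      · intro hx hx'; exact hroot (hx' ▸ hx)
      · intro hx; by_contra h3; exact h2 ⟨hx, h3⟩
    · have : petersenRoot ∈ R := h1 ▸ Set.mem_univ _
      exact absurd rfl ((hmemR _).1 this).1

/-- There is no set `Q` of vertices of degree two that carries a path through the Petersen graph
minus its root. -/
theorem CutGood.petersen_no_short_crossing (hc : CutGood petersenRot h) {Q : Set PetersenVertex}
    (hroot : petersenRoot ∉ Q) (hQ : ∀ x ∈ Q, ¬ ∀ i, h (x, i)) {d₁ d₂ : PetersenVertex × Fin 3}
    (hcr : ∀ d, Crosses petersenRot h Q d → d = d₁ ∨ d = d₂) {j j' : Fin 3} (hjj : j ≠ j')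
    (hj : h (petersenRoot, j)) (hj' : h (petersenRoot, j'))
    (hjQ : (petersenRot (petersenRoot, j)).1 ∈ Q)
    (hjQ' : (petersenRot (petersenRoot, j')).1 ∈ Q) : False := by
  have hportcr : ∀ k, h (petersenRoot, k) → (petersenRot (petersenRoot, k)).1 ∈ Q →
      Crosses petersenRot h Q (petersenRot (petersenRoot, k)) := by
    intro k hk hkQ
    exact ⟨(hc.symm _).2 hk, hkQ, by rwa [petersenRot_petersenRot]⟩
  -- The edges of `Q` to the root at `j` and `j'` already account for both permitted crossings.
  have hports : ∀ d, Crosses petersenRot h Q d →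
      d = petersenRot (petersenRoot, j) ∨ d = petersenRot (petersenRoot, j') := by
    have hne : petersenRot (petersenRoot, j) ≠ petersenRot (petersenRoot, j') := by
      intro h1
      exact hjj (petersenRot_fst_inj _ _ _ (congrArg Prod.fst h1))
    intro d hd
    have h1 := hcr _ (hportcr j hj hjQ)
    have h2 := hcr _ (hportcr j' hj' hjQ')
    have h3 := hcr d hd
    rcases h1 with h1 | h1 <;> rcases h2 with h2 | h2 <;> rcases h3 with h3 | h3 <;> simp_all
  set R := (insert petersenRoot Q)ᶜ with hR
  have hmemR : ∀ x, x ∈ R ↔ x ≠ petersenRoot ∧ x ∉ Q := by intro x; simp [hR]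
  have toRoot : ∀ d, Crosses petersenRot h R d → (petersenRot d).1 = petersenRoot ∧
      (petersenRot d).2 ≠ j ∧ (petersenRot d).2 ≠ j' := by
    intro d hd
    have h1 := (hmemR _).1 hd.2.1
    have h0 : (petersenRot d).1 = petersenRoot := by
      by_contra hne
      have h2 : (petersenRot d).1 ∈ Q := by
        by_contra h2
        exact hd.2.2 ((hmemR _).2 ⟨hne, h2⟩)
      rcases hports (petersenRot d) ⟨(hc.symm d).2 hd.1, h2, by
        rw [petersenRot_petersenRot]; exact h1.2⟩ with h3 | h3 <;>
      · have := congrArg petersenRot h3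
        rw [petersenRot_petersenRot, petersenRot_petersenRot] at this
        exact h1.1 (congrArg Prod.fst this)
    refine ⟨h0, ?_, ?_⟩
    · rintro h2
      have : petersenRot d = (petersenRoot, j) := Prod.ext h0 h2
      rw [← this, petersenRot_petersenRot] at hjQ
      exact h1.2 hjQ
    · rintro h2
      have : petersenRot d = (petersenRoot, j') := Prod.ext h0 h2
      rw [← this, petersenRot_petersenRot] at hjQ'
      exact h1.2 hjQ'
  -- Only the third edge at the root can leave `R`, and alone it would be a bridge.
  have hRcr : ∀ d, ¬ Crosses petersenRot h R d := by
    intro d hd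
    obtain ⟨d', hne, hd'⟩ := hc.two _ _ hd
    obtain ⟨a1, a2, a3⟩ := toRoot d hd
    obtain ⟨b1, b2, b3⟩ := toRoot d' hd'
    have : (petersenRot d').2 ≠ (petersenRot d).2 := fun heq =>
      hne (petersen_eq_of_fst_eq_root b1 a1 heq)
    omega
  have hall : ∀ x, x ≠ petersenRoot → x ∈ Q := by
    intro x hx
    by_contra hxQ
    rcases hc.closed_of_forall_not_crosses hRcr with h1 | h1
    · exact Set.notMem_empty x (h1 ▸ (hmemR x).2 ⟨hx, hxQ⟩)
    · have : petersenRoot ∈ R := h1 ▸ Set.mem_univ _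
      exact absurd rfl ((hmemR _).1 this).1
  -- Now `Q` contains all vertices but the root, so every vertex has degree two: those in `Q` by
  -- assumption, the root because a third edge there would be a third crossing of `Q`. Thus `h` is a
  -- 2-factor and contains a closed pentagon.
  have hdeg : ∀ x, ∃ i, ∀ k, h (x, k) ↔ k ≠ i := by
    intro x
    have hnb : ∃ i, ¬ h (x, i) := by
      by_cases hx : x = petersenRoot
      · subst hx
        obtain ⟨k, hk, hk'⟩ : ∃ k : Fin 3, k ≠ j ∧ k ≠ j' :=
          (by decide : ∀ a b : Fin 3, ∃ k : Fin 3, k ≠ a ∧ k ≠ b) j j'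
        refine ⟨k, fun hhk => ?_⟩
        rcases hports _ (hportcr k hhk (hall _ (petersenRot_root_ne k))) with h1 | h1
        · exact hk (petersenRot_fst_inj _ _ _ (congrArg Prod.fst h1))
        · exact hk' (petersenRot_fst_inj _ _ _ (congrArg Prod.fst h1))
      · simpa using hQ x (hall x hx)
    obtain ⟨i, hi⟩ := hnb
    obtain ⟨a, b, hab, ha, hb⟩ := hc.exists_two x
    refine ⟨i, fun k => ⟨fun hk hki => hi (hki ▸ hk), fun hk => ?_⟩⟩
    have hai : a ≠ i := fun h => hi (h ▸ ha)
    have hbi : b ≠ i := fun h => hi (h ▸ hb)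
    have : k = a ∨ k = b := by omega
    rcases this with rfl | rfl <;> assumption
  obtain ⟨S, hodd, -, hS⟩ := petersen_two_factor h hc.symm hdeg
  obtain ⟨d, hd⟩ := hc.odd S hodd
  exact hd.2.2 (hS d hd.1 hd.2.1)

end Petersen

/-! ### Connectedness of the spanning subgraph at every level -/

section Connected

variable {V : Type} {r : V × Fin 3 → V × Fin 3}

/-- A set that no edge of `h` leaves is a union of copies of `P`. -/
theorem CutGood.closed_eq_preimage {h : (V × PVertex) × Fin 3 → Prop} (hr : IsRot r)
    (hc : CutGood (inflateRot r) h) {S : Set (V × PVertex)}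
    (hS : IsClosedFor (inflateRot r) h S) (v : V) (p q : PVertex) (hp : (v, p) ∈ S) :
    (v, q) ∈ S := by
  rcases (hc.local hr v).petersen_sub_root (T := {x | ∃ hx : x ≠ petersenRoot, (v, ⟨x, hx⟩) ∈ S})
    (by simp) (by
      rintro ⟨x, i⟩ hd h1 h2 ⟨h3, h4⟩
      have h5 := localEnd_of_ne v ⟨x, h1⟩ i
      dsimp only at hd h5
      rw [h5] at hd
      have := (hS _ hd).1 h4
      rw [inflateRot_of_ne_root v ⟨x, h1⟩ i h2] at this
      exact ⟨h2, this⟩) with h1 | h1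
  · exact absurd ⟨p.2, hp⟩ (Set.eq_empty_iff_forall_notMem.1 h1 p.1)
  · have : q.1 ∈ {x | ∃ hx : x ≠ petersenRoot, ((v, ⟨x, hx⟩) : V × PVertex) ∈ S} := by
      rw [h1]; exact q.2
    exact this.2

/-- By `CutGood.closed_eq_preimage` a closed set is a union of whole copies of `P`, so it comes from
a closed set one level below. -/
theorem CutGood.connected : ∀ (k : ℕ) {h : IterVertex k × Fin 3 → Prop},
    CutGood (iterRot k) h → ∀ {S : Set (IterVertex k)}, IsClosedFor (iterRot k) h S →
      S = ∅ ∨ S = Set.univ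
  | 0, _, hc, _, hS => hc.petersen_connected hS
  | k + 1, h, hc, S, hS => by
    have hmem : ∀ (x : IterVertex k × PVertex) (q : PVertex), x ∈ S → (x.1, q) ∈ S :=
      fun x q hx => CutGood.closed_eq_preimage (isRot_iterRot k) hc hS x.1 x.2 q hx
    have hcl : IsClosedFor (iterRot k) (fun d => h (inflateEnd d))
        {v | ∃ p, (v, p) ∈ S} := by
      rw [isClosedFor_iff (isRot_iterRot k).invol (CutGood.contract hc).symm]
      rintro d ⟨h1, ⟨p, h2⟩, h3⟩
      have h4 := (hS (inflateEnd d) h1).1 (hmem _ _ h2)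
      have h5 : iterRot (k + 1) (inflateEnd d) = inflateEnd (iterRot k d) :=
        inflateRot_inflateEnd d
      rw [h5] at h4
      exact h3 ⟨_, h4⟩
    rcases CutGood.connected k (CutGood.contract hc) hcl with h1 | h1
    · left
      ext ⟨v, p⟩
      refine ⟨fun hx => ?_, fun h => absurd h (Set.notMem_empty _)⟩
      exact absurd ⟨p, hx⟩ (Set.eq_empty_iff_forall_notMem.1 h1 v)
    · right
      ext ⟨v, p⟩
      have : v ∈ {v | ∃ p, (v, p) ∈ S} := h1 ▸ Set.mem_univ v
      obtain ⟨q, hq⟩ := this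
      exact ⟨fun _ => Set.mem_univ _, fun _ => hmem _ p hq⟩

end Connected

/-! ### Potentials on the edges of the Petersen graph -/

/-- The number of vertices other than the root that a path from the `j`-th edge at the root to a
given edge passes through. -/
def petersenDist (j : Fin 3) : PetersenVertex × Fin 3 → ℕ
  | ((false, i), t) => (![![![0, 4, 4], ![1, 0, 1], ![2, 1, 2], ![3, 2, 3], ![4, 3, 3]],
      ![![4, 0, 4], ![3, 4, 3], ![2, 3, 3], ![1, 2, 2], ![0, 1, 1]],
      ![![4, 4, 0], ![3, 4, 3], ![3, 3, 2], ![3, 3, 2], ![4, 3, 3]]] :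
      Fin 3 → Fin 5 → Fin 3 → ℕ) j i t
  | ((true, i), t) => (![![![3, 3, 4], ![2, 2, 1], ![3, 3, 2], ![3, 2, 3], ![2, 3, 3]],
      ![![3, 3, 4], ![3, 2, 3], ![2, 3, 3], ![3, 3, 2], ![2, 2, 1]],
      ![![1, 1, 0], ![2, 3, 3], ![2, 1, 2], ![1, 2, 2], ![3, 2, 3]]] :
      Fin 3 → Fin 5 → Fin 3 → ℕ) j i t

/-- The number of vertices that a path from the root to a given edge passes through. -/
def petersenDepth (d : PetersenVertex × Fin 3) : ℕ :=
  if d.1 = petersenRoot ∨ (petersenRot d).1 = petersenRoot then 0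
  else if (∃ j, (petersenRot (d.1, j)).1 = petersenRoot) ∨
    ∃ j, (petersenRot ((petersenRot d).1, j)).1 = petersenRoot then 1 else 2

/-- A function on the edges of the Petersen graph that grows by at most one when passing through
a vertex other than the root. -/
structure IsPotential (L : PetersenVertex × Fin 3 → ℕ) : Prop where
  lip : ∀ q i j, q ≠ petersenRoot → L (q, i) ≤ L (q, j) + 1
  edge : ∀ d, L (petersenRot d) = L d

theorem isPotential_petersenDist (j : Fin 3) : IsPotential (petersenDist j) := by
  constructor
  · revert j; unfold petersenRoot; decide
  · revert j; decide

theorem petersenDist_root : ∀ j, petersenDist j (petersenRoot, j) = 0 := by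
  unfold petersenRoot; decide

/-- The value 4 reflects girth five: a path between two neighbours of the root that avoids the root
has at least four vertices. -/
theorem petersenDist_root_of_ne :
    ∀ j j', j ≠ j' → petersenDist j (petersenRoot, j') = 4 := by
  unfold petersenRoot; decide

theorem isPotential_petersenDepth : IsPotential petersenDepth := by
  constructor
  · unfold petersenDepth petersenRoot; decide
  · unfold petersenDepth petersenRoot; decide

theorem petersenDepth_root : ∀ j, petersenDepth (petersenRoot, j) = 0 := by
  intro j; simp [petersenDepth]

/-- A vertex of the Petersen graph that is not adjacent to the root. -/
def petersenFar : PVertex := ⟨(false, 2), by unfold petersenRoot; decide⟩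

/-- Edge 1 at this vertex leads to a neighbour of the root. The other two lead to vertices that are
not adjacent to the root. -/
theorem petersenDepth_far : ∀ t, petersenDepth (petersenFar.1, t) = if t = 1 then 1 else 2 := by
  unfold petersenDepth petersenFar petersenRoot; decide

/-! ### Walks and their number of branch vertices -/

section Walks

variable {U W V : Type} {R : U × Fin 3 → U × Fin 3} {s : W × Fin 3 → W × Fin 3}
  {r : V × Fin 3 → V × Fin 3} {h : U × Fin 3 → Prop}

/-- The vertex `u` has degree three in `h`. -/
def IsBranch (h : U × Fin 3 → Prop) (u : U) : Prop := ∀ i, h (u, i)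

open Classical in
/-- A branch vertex costs one, every other vertex is free. -/
def branchCost (h : U × Fin 3 → Prop) (u : U) : ℕ := if IsBranch h u then 1 else 0

theorem branchCost_eq_zero {u : U} : branchCost h u = 0 ↔ ¬ IsBranch h u := by
  unfold branchCost; split <;> simp_all

/-- `Reach R h X a u n`: some walk along `h` in `X` leads from `a` to `u` and has `n` branch
vertices. -/
inductive Reach (R : U × Fin 3 → U × Fin 3) (h : U × Fin 3 → Prop) (X : Set U) (a : U) :
    U → ℕ → Prop
  | refl : Reach R h X a a (branchCost h a)
  | step {u : U} {n : ℕ} (i : Fin 3) : Reach R h X a u n → h (u, i) → (R (u, i)).1 ∈ X →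
      Reach R h X a (R (u, i)).1 (n + branchCost h (R (u, i)).1)

theorem Reach.mem {X : Set U} {a u : U} {n : ℕ} (hu : Reach R h X a u n) (ha : a ∈ X) :
    u ∈ X := by
  cases hu with
  | refl => exact ha
  | step i _ _ h2 => exact h2

theorem Reach.branchCost_le {X : Set U} {a u : U} {n : ℕ} (hu : Reach R h X a u n) :
    branchCost h u ≤ n := by
  cases hu with
  | refl => exact le_rfl
  | step i _ _ h2 => omega

/-- A walk without branch vertices can be traversed backwards at no cost. -/
theorem Reach.extend_back {X : Set U} {p u : U} {n₀ : ℕ} (hu : Reach R h X p u n₀)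
    (hi : ∀ d, R (R d) = d) (hs : ∀ d, h (R d) ↔ h d) (hp : p ∈ X) (h0 : n₀ = 0) {a : U} {n : ℕ}
    (ha : Reach R h X a u n) : Reach R h X a p n := by
  induction hu generalizing n with
  | refl => exact ha
  | @step u n₁ i hu h1 h2 ih =>
    have hn : n₁ = 0 := by omega
    subst hn
    apply ih rfl
    have hcost : branchCost h u = 0 := by
      have := hu.branchCost_le
      omega
    have := Reach.step (R (u, i)).2 ha ((hs _).2 h1) (by
      rw [Prod.mk.eta, hi]; exact hu.mem hp)
    rw [Prod.mk.eta, hi] at this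
    simpa [hcost] using this

/-- The map `π` contracts the cubic graph `R` onto the cubic graph `s`, and `ι` sends the edges of
`s` to the edges that are not contracted. -/
structure Contraction (R : U × Fin 3 → U × Fin 3) (s : W × Fin 3 → W × Fin 3) (π : U → W)
    (ι : W × Fin 3 → U × Fin 3) : Prop where
  proj : ∀ d, π (ι d).1 = d.1
  rot : ∀ d, R (ι d) = ι (s d)
  inj : Function.Injective ι
  cases : ∀ x, π (R x).1 = π x.1 ∨ ∃ d, x = ι d

theorem contraction_inflate (r : V × Fin 3 → V × Fin 3) :
    Contraction (inflateRot r) r Prod.fst inflateEnd where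
  proj _ := rfl
  rot := inflateRot_inflateEnd
  inj := inflateEnd_injective
  cases x := (inflateRot_cases x).imp (fun h => h.1) id

theorem Contraction.comp_inflate {π : U → V × PVertex} {ι : (V × PVertex) × Fin 3 → U × Fin 3}
    (C : Contraction R (inflateRot r) π ι) :
    Contraction R r (fun u => (π u).1) (fun d => ι (inflateEnd d)) where
  proj d := by rw [C.proj]; rfl
  rot d := by rw [C.rot, inflateRot_inflateEnd]
  inj := C.inj.comp inflateEnd_injective
  cases x := by
    rcases C.cases x with h1 | ⟨d, rfl⟩
    · exact Or.inl (by rw [h1])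
    · rcases inflateRot_cases (r := r) d with h1 | ⟨e, rfl⟩
      · left; rw [C.rot, C.proj, C.proj, h1.1]
      · exact Or.inr ⟨e, rfl⟩

/-- Every walk through a fibre, from one edge that leaves the fibre to another one, has at least
`m` branch vertices. -/
def CrossBound (R : U × Fin 3 → U × Fin 3) (h : U × Fin 3 → Prop) (π : U → W)
    (ι : W × Fin 3 → U × Fin 3) (m : ℕ) : Prop :=
  ∀ w j j' n, j ≠ j' → h (ι (w, j)) → h (ι (w, j')) →
    Reach R h {u | π u = w} (ι (w, j)).1 (ι (w, j')).1 n → m ≤ n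

/-- A lower bound for the number `n` of branch vertices on a walk to `u`, in terms of a potential
`L` on the edges of the copy of the Petersen graph at `v`. -/
def LowerBound (R : U × Fin 3 → U × Fin 3) (h : U × Fin 3 → Prop) (π : U → V × PVertex)
    (ι : (V × PVertex) × Fin 3 → U × Fin 3) (m : ℕ) (L : PetersenVertex × Fin 3 → ℕ) (v : V)
    (u : U) (n : ℕ) : Prop :=
  ∀ q, π u = (v, q) → ∃ t n', h (ι ((v, q), t)) ∧
    Reach R h {u | π u = (v, q)} (ι ((v, q), t)).1 u n' ∧ m * L (q.1, t) + n' ≤ n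

/-! ### Lower bounds for walks from potentials -/

section LowerBound

variable {π : U → V × PVertex} {ι : (V × PVertex) × Fin 3 → U × Fin 3} {m : ℕ}
  {L : PetersenVertex × Fin 3 → ℕ} {v : V}

/-- Either the walk is back at the edge through which it entered the fibre, or it has crossed the
fibre. In the latter case it has paid `m`, while `L` has grown by at most one. -/
theorem LowerBound.le_of_port (hcb : CrossBound R h π ι m) (hL : IsPotential L) {q : PVertex}
    {k : Fin 3} {n : ℕ} (C : Contraction R (inflateRot r) π ι) (hk : h (ι ((v, q), k)))
    (hb : LowerBound R h π ι m L v (ι ((v, q), k)).1 n) : m * L (q.1, k) ≤ n := by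
  obtain ⟨t, n', h1, h2, h3⟩ := hb q (C.proj _)
  by_cases htk : t = k
  · subst htk; omega
  · have h4 := hcb _ _ _ _ htk h1 hk h2
    have h5 := Nat.mul_le_mul_left m (hL.lip q.1 k t q.2)
    rw [Nat.mul_add] at h5
    omega

/-- Within a fibre the inner walk is prolonged. On leaving the fibre, `LowerBound.le_of_port` turns
the inner walk into a bound in terms of `L` at the edge used, and the inner walk restarts as a
single vertex of the next fibre. -/
theorem LowerBound.step (hr : IsRot r) (hcb : CrossBound R h π ι m) (hL : IsPotential L)
    (C : Contraction R (inflateRot r) π ι) (hs : ∀ d, h (R d) ↔ h d) {u : U} {n : ℕ} (i : Fin 3)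
    (hb : LowerBound R h π ι m L v u n) (hu : (π u).1 = v) (hi : h (u, i)) :
    LowerBound R h π ι m L v (R (u, i)).1 (n + branchCost h (R (u, i)).1) := by
  intro q' hq'
  rcases C.cases (u, i) with h1 | ⟨⟨x, j⟩, hd⟩
  · dsimp only at h1
    obtain ⟨t, n', h2, h3, h4⟩ := hb q' (h1 ▸ hq')
    exact ⟨t, _, h2, h3.step i hi hq', by omega⟩
  · have hux : u = (ι (x, j)).1 := congrArg Prod.fst hd
    have hπu : π u = x := by rw [hux, C.proj]
    obtain ⟨w, q⟩ := x
    obtain rfl : w = v := by rw [hπu] at hu; exact hu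
    rw [hd, C.rot]
    rw [hd, C.rot, C.proj] at hq'
    have hle : m * L (q.1, j) ≤ n :=
      LowerBound.le_of_port hcb hL C (hd ▸ hi) (hux ▸ hb)
    have hport : (inflateRot r ((w, q), j)) = ((w, q'), (inflateRot r ((w, q), j)).2) :=
      Prod.ext hq' rfl
    refine ⟨(inflateRot r ((w, q), j)).2, branchCost h (ι (inflateRot r ((w, q), j))).1, ?_, ?_, ?_⟩
    · rw [← hport, ← C.rot, hs, ← hd]; exact hi
    · rw [← hport]; exact Reach.refl
    · rcases inflateRot_cases (r := r) ((w, q), j) with h1 | ⟨e, he⟩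
      · rw [hq'] at h1
        have h2 : petersenRot (q.1, j) = (q'.1, (inflateRot r ((w, q), j)).2) :=
          Prod.ext h1.2.1 h1.2.2
        rw [← h2, hL.edge]
        omega
      -- An original edge would leave the copy at `w`, as there are no loops, but the new vertex
      -- lies in that copy.
      · exfalso
        rw [he, inflateRot_inflateEnd] at hq'
        have h2 : w = e.1 := congrArg (fun y => y.1.1) he
        have h3 : (r e).1 = w := congrArg Prod.fst hq'
        exact hr.loopless e (h3.trans h2)

/-- An edge that enters the copy at `v` stands for an edge at the root, where the potential
vanishes. -/
theorem LowerBound.enter (hL : IsPotential L) (hL0 : ∀ j, L (petersenRoot, j) = 0)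
    (C : Contraction R (inflateRot r) π ι) (hs : ∀ d, h (R d) ↔ h d) {u : U} {n : ℕ} (i : Fin 3)
    (hu : (π u).1 ≠ v) (hi : h (u, i)) :
    LowerBound R h π ι m L v (R (u, i)).1 (n + branchCost h (R (u, i)).1) := by
  intro q' hq'
  rcases C.comp_inflate.cases (u, i) with h1 | ⟨d, hd⟩
  · dsimp only at h1
    rw [hq'] at h1
    exact absurd h1.symm hu
  · rw [hd, C.rot, inflateRot_inflateEnd] at hq' ⊢
    rw [C.proj] at hq'
    have h1 : (r d).1 = v := congrArg Prod.fst hq'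
    have h2 : q'.1 = (petersenRot (petersenRoot, (r d).2)).1 :=
      (congrArg (fun y => y.2.1) hq').symm
    have hport : inflateEnd (r d) = ((v, q'), (inflateEnd (r d)).2) := Prod.ext hq' rfl
    refine ⟨(inflateEnd (r d)).2, branchCost h (ι (inflateEnd (r d))).1, ?_, ?_, ?_⟩
    · rw [← hport, ← inflateRot_inflateEnd, ← C.rot, hs, ← hd]; exact hi
    · rw [← hport]; exact Reach.refl
    · have h3 : (q'.1, (inflateEnd (r d)).2) = petersenRot (petersenRoot, (r d).2) :=
        Prod.ext h2 rfl
      rw [h3, hL.edge, hL0]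
      omega

end LowerBound

/-- The potential is the distance from the `j`-th edge at the root. It is 0 where the walk enters
and 4 where it leaves. -/
theorem CrossBound.inflate {π : U → V × PVertex} {ι : (V × PVertex) × Fin 3 → U × Fin 3} {m : ℕ}
    (hr : IsRot r) (hcb : CrossBound R h π ι m) (C : Contraction R (inflateRot r) π ι)
    (hs : ∀ d, h (R d) ↔ h d) :
    CrossBound R h (fun u => (π u).1) (fun d => ι (inflateEnd d)) (m * 4) := by
  intro v j j' n hjj hj hj' hreach
  have key : ∀ u n, Reach R h {u | (π u).1 = v} (ι (inflateEnd (v, j))).1 u n →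
      LowerBound R h π ι m (petersenDist j) v u n := by
    intro u n hu
    induction hu with
    | refl =>
      intro q hq
      rw [C.proj] at hq
      have hport : inflateEnd (v, j) = ((v, q), (inflateEnd (v, j)).2) := Prod.ext hq rfl
      refine ⟨(inflateEnd (v, j)).2, branchCost h (ι (inflateEnd (v, j))).1, ?_, ?_, ?_⟩
      · rw [← hport]; exact hj
      · rw [← hport]; exact Reach.refl
      · have h3 : (q.1, (inflateEnd (v, j)).2) = petersenRot (petersenRoot, j) :=
          Prod.ext (congrArg (fun y => y.2.1) hq).symm rfl
        rw [h3, (isPotential_petersenDist j).edge, petersenDist_root]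
        omega
    | step i hu h1 h2 ih =>
      exact ih.step hr hcb (isPotential_petersenDist j) C hs i (by
        apply hu.mem (X := {u | (π u).1 = v}); simp [C.proj]) h1
  have h1 := LowerBound.le_of_port hcb (isPotential_petersenDist j) C
    (k := (inflateEnd (v, j')).2) hj' (key _ _ hreach)
  have h3 : petersenDist j ((petersenRot (petersenRoot, j')).1, (inflateEnd (v, j')).2) = 4 := by
    have := (isPotential_petersenDist j).edge (petersenRoot, j')
    rw [petersenDist_root_of_ne j j' hjj] at this
    exact this
  dsimp only at h1
  rwa [h3] at h1

/-- Every walk through a single copy of `P` meets a branch vertex. -/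
theorem crossBound_one {h : (V × PVertex) × Fin 3 → Prop} (hr : IsRot r)
    (hc : CutGood (inflateRot r) h) : CrossBound (inflateRot r) h Prod.fst inflateEnd 1 := by
  intro v j j' n hjj hj hj' hreach
  by_contra hn
  have hn0 : n = 0 := by omega
  clear hn
  set g : PetersenVertex × Fin 3 → Prop := fun d => h (localEnd v d) with hg
  have hgc : CutGood petersenRot g := hc.local hr v
  have hgp : ∀ (p : PVertex) i, g (p.1, i) ↔ h ((v, p), i) := by
    intro p i; rw [hg]; dsimp only; rw [localEnd_of_ne]
  -- A walk without branch vertices sweeps out a set `Q` of vertices of degree at most two, and at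
  -- most two edges leave `Q` at any time.
  have key : ∀ (u : V × PVertex) n, Reach (inflateRot r) h {u : V × PVertex | u.1 = v} (inflateEnd (v, j)).1 u n → n = 0 →
      ∃ Q : Set PetersenVertex, petersenRoot ∉ Q ∧ (∀ x ∈ Q, ¬ ∀ i, g (x, i)) ∧
        (∃ d₁ d₂, ∀ d, Crosses petersenRot g Q d → d = d₁ ∨ d = d₂) ∧
        (petersenRot (petersenRoot, j)).1 ∈ Q ∧ u.2.1 ∈ Q := by
    intro u n hu hn
    induction hu with
    | refl =>
      rw [branchCost_eq_zero] at hn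
      obtain ⟨i, hi⟩ := not_forall.1 hn
      refine ⟨{(petersenRot (petersenRoot, j)).1}, (petersenRot_root_ne j).symm, ?_, ?_,
        rfl, rfl⟩
      · rintro x rfl hx
        exact hi ((hgp ⟨_, petersenRot_root_ne j⟩ i).1 (hx i))
      · obtain ⟨a, b, hab⟩ := (by decide : ∀ i : Fin 3, ∃ a b : Fin 3, ∀ k, k = i ∨ k = a ∨ k = b) i
        refine ⟨((petersenRot (petersenRoot, j)).1, a), ((petersenRot (petersenRoot, j)).1, b), ?_⟩
        rintro ⟨x, k⟩ ⟨h1, h2, -⟩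
        obtain rfl : x = _ := h2
        rcases hab k with rfl | rfl | rfl
        · exact absurd ((hgp ⟨_, petersenRot_root_ne j⟩ _).1 h1) hi
        · exact Or.inl rfl
        · exact Or.inr rfl
    | @step u n i hu h1 h2 ih =>
      obtain ⟨Q, hroot, hQ, ⟨d₁, d₂, hcr⟩, hjQ, huQ⟩ := ih (by omega)
      have hcost : ¬ IsBranch h (inflateRot r (u, i)).1 := branchCost_eq_zero.1 (by omega)
      by_cases hmem : (inflateRot r (u, i)).1.2.1 ∈ Q
      · exact ⟨Q, hroot, hQ, ⟨d₁, d₂, hcr⟩, hjQ, hmem⟩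
      have huv : u.1 = v := hu.mem (X := {u : V × PVertex | u.1 = v}) rfl
      obtain ⟨w, p⟩ := u
      obtain rfl : w = v := huv
      rcases inflateRot_cases (r := r) ((w, p), i) with h3 | ⟨e, he⟩
      swap
      · exfalso
        have h4 : w = e.1 := congrArg (fun y => y.1.1) he
        rw [he, inflateRot_inflateEnd] at h2
        exact hr.loopless e (Eq.trans h2 h4)
      obtain ⟨h3, h4, h5⟩ := h3
      generalize hy : inflateRot r ((w, p), i) = y at *
      obtain ⟨⟨w', p'⟩, k⟩ := y
      obtain rfl : w' = w := h3
      dsimp only at h4 h5 hmem hcost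
      have hrot : petersenRot (p.1, i) = (p'.1, k) := Prod.ext h4 h5
      have hrot' : petersenRot (p'.1, k) = (p.1, i) := by rw [← hrot, petersenRot_petersenRot]
      have hgD : g (p.1, i) := (hgp p i).2 h1
      have hgk : g (p'.1, k) := by rw [← hrot]; exact (hgc.symm _).2 hgD
      have hD : Crosses petersenRot g Q (p.1, i) := ⟨hgD, huQ, by rw [hrot]; exact hmem⟩
      obtain ⟨i₀, hi₀⟩ := not_forall.1 hcost
      rw [← hgp] at hi₀
      obtain ⟨i₁, hi₁⟩ := (by decide : ∀ a b : Fin 3, ∃ c : Fin 3, a ≠ b → ∀ k, k = a ∨ k = b ∨ k = c)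
        i₀ k
      have hi₁' := hi₁ (fun h => hi₀ (h ▸ hgk))
      -- Adding the new vertex `p'` turns the crossing `(p, i)` into an inner edge and creates at
      -- most the one crossing `(p', i₁)`, because the edge `i₀` at `p'` is absent.
      have hcr' : ∃ e, ∀ d, Crosses petersenRot g Q d → d = (p.1, i) ∨ d = e := by
        rcases hcr _ hD with h6 | h6
        · exact ⟨d₂, fun d hd => by rw [h6]; exact hcr d hd⟩
        · exact ⟨d₁, fun d hd => by rw [h6]; exact (hcr d hd).symm⟩
      obtain ⟨e, he⟩ := hcr'
      refine ⟨insert p'.1 Q, ?_, ?_, ⟨e, (p'.1, i₁), ?_⟩, Or.inr hjQ, Or.inl rfl⟩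
      · rintro (h6 | h6)
        · exact p'.2 h6.symm
        · exact hroot h6
      · rintro x (rfl | hx)
        · exact fun h => hi₀ (h i₀)
        · exact hQ x hx
      · rintro ⟨x, a⟩ ⟨h6, h7 | h7, h8⟩
        · right
          obtain rfl : x = p'.1 := h7
          rcases hi₁' a with rfl | rfl | rfl
          · exact absurd h6 hi₀
          · exact absurd (by rw [hrot']; exact Or.inr huQ) h8
          · rfl
        · left
          rcases he _ ⟨h6, h7, fun h => h8 (Or.inr h)⟩ with h9 | h9
          · exact absurd (by rw [h9, hrot]; exact Or.inl rfl) h8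
          · exact h9
  obtain ⟨Q, hroot, hQ, ⟨d₁, d₂, hcr⟩, hjQ, huQ⟩ := key _ _ hreach hn0
  refine hgc.petersen_no_short_crossing hroot hQ hcr hjj ?_ ?_ hjQ huQ
  · rw [hg]; dsimp only; rw [localEnd_root]; exact hj
  · rw [hg]; dsimp only; rw [localEnd_root]; exact hj'

/-- Every fibre has a branch vertex that is far away from all but one of the edges that leave the
fibre. -/
theorem CrossBound.exists_branch {π : U → W} {ι : W × Fin 3 → U × Fin 3} {m : ℕ}
    (hcb : CrossBound R h π ι m) (C : Contraction R s π ι) (hs : ∀ d, (s d).1 ≠ d.1)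
    (hi : ∀ d, R (R d) = d) (hc : CutGood R h) (hm : 1 ≤ m) (w : W) (t₂ : Fin 3)
    (ht₂ : h (ι (w, t₂))) :
    ∃ x, π x = w ∧ IsBranch h x ∧ ∀ t₁, t₁ ≠ t₂ → h (ι (w, t₁)) → ∀ n,
      Reach R h {u | π u = w} (ι (w, t₁)).1 x n → m ≤ n := by
  have hp : (ι (w, t₂)).1 ∈ {u | π u = w} := C.proj _
  by_cases hbr : IsBranch h (ι (w, t₂)).1
  · exact ⟨_, hp, hbr, fun t₁ hne ht₁ n hn => hcb _ _ _ _ hne ht₁ ht₂ hn⟩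
  -- The vertices reachable from the edge `t₂` for free. As this edge is not a bridge, a second edge
  -- leaves `Z`. It stays in the fibre and ends in the desired branch vertex, since a second exit
  -- from the fibre would give a free crossing.
  set Z : Set U := {u | Reach R h {u | π u = w} (ι (w, t₂)).1 u 0} with hZ
  have hZw : ∀ u ∈ Z, π u = w := fun u hu => Reach.mem (X := {u | π u = w}) hu hp
  have hcr : Crosses R h Z (ι (w, t₂)) := by
    refine ⟨ht₂, ?_, fun h1 => ?_⟩
    · have := Reach.refl (R := R) (h := h) (X := {u | π u = w}) (a := (ι (w, t₂)).1)
      rwa [branchCost_eq_zero.2 hbr] at this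
    · have := hZw _ h1
      rw [C.rot, C.proj] at this
      exact hs _ this
  obtain ⟨⟨u, i⟩, hne, h1, h2, h3⟩ := hc.two _ _ hcr
  rcases C.cases (u, i) with h4 | ⟨⟨y, j⟩, hd⟩
  · dsimp only at h4 h2
    have h5 : π (R (u, i)).1 = w := h4.trans (hZw u h2)
    have h6 := Reach.step i h2 h1 h5
    refine ⟨(R (u, i)).1, h5, ?_, ?_⟩
    · by_contra hnb
      rw [branchCost_eq_zero.2 hnb] at h6
      exact h3 h6
    -- From the branch vertex one returns for free through `Z` to the edge `t₂`, so a walk from `t₁`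
    -- to it extends to a crossing of the same cost.
    · intro t₁ hne₁ ht₁ n hn
      have h7 := hn.step (R (u, i)).2 ((hc.symm _).2 h1) (by
        rw [Prod.mk.eta, hi]; exact hZw u h2)
      rw [Prod.mk.eta, hi] at h7
      have h8 : branchCost h u = 0 := by
        have := Reach.branchCost_le h2
        omega
      dsimp only at h7
      rw [h8] at h7
      exact hcb _ _ _ _ hne₁ ht₁ ht₂ (Reach.extend_back h2 hi hc.symm hp rfl h7)
  · exfalso
    have hux : u = (ι (y, j)).1 := congrArg Prod.fst hd
    obtain rfl : y = w := by rw [← hZw u h2, hux, C.proj]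
    have hjt : t₂ ≠ j := fun h => hne (by rw [hd, h])
    have := hcb _ _ _ _ hjt ht₂ (hd ▸ h1) (hux ▸ h2)
    omega

end Walks

/-- Here `i + 1` inflations are contracted. The innermost contributes the factor 1, each of the
others the factor 4. -/
theorem exists_contraction_crossBound (n : ℕ) {h : IterVertex n × Fin 3 → Prop}
    (hc : CutGood (iterRot n) h) : ∀ i k, k + i + 1 = n → ∃ π ι,
      Contraction (iterRot n) (iterRot k) π ι ∧ CutGood (iterRot k) (fun d => h (ι d)) ∧
      CrossBound (iterRot n) h π ι (4 ^ i) := by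
  intro i
  induction i with
  | zero =>
    rintro k rfl
    exact ⟨Prod.fst, inflateEnd, contraction_inflate _, hc.contract,
      crossBound_one (isRot_iterRot k) hc⟩
  | succ i ih =>
    intro k hk
    obtain ⟨π, ι, C, hcι, hcb⟩ := ih (k + 1) (by omega)
    exact ⟨_, _, Contraction.comp_inflate (V := IterVertex k) C,
      CutGood.contract (V := IterVertex k) hcι,
      CrossBound.inflate (V := IterVertex k) (isRot_iterRot k) hcb C hc.symm⟩

/-! ### Circuits and the parts they miss -/

section Circuits

variable {U W : Type} {R : U × Fin 3 → U × Fin 3} {s : W × Fin 3 → W × Fin 3}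
  {c : U × Fin 3 → Prop} {N : Set U}

/-- The edge set `c` and the vertex set `N` behave like those of a circuit: `c` meets every cut in
an even number of edges, and it meets every cut that separates `N`. -/
structure CircuitLike (R : U × Fin 3 → U × Fin 3) (c : U × Fin 3 → Prop) (N : Set U) : Prop where
  symm : ∀ d, c (R d) ↔ c d
  even : ∀ T, Even {d | Crosses R c T d}.ncard
  conn : ∀ T : Set U, (∃ x ∈ N, x ∈ T) → (∃ x ∈ N, x ∉ T) → ∃ d, Crosses R c T d

theorem Contraction.crosses_preimage {π : U → W} {ι : W × Fin 3 → U × Fin 3}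
    (C : Contraction R s π ι) (T : Set W) (x : U × Fin 3) :
    Crosses R c (π ⁻¹' T) x ↔ ∃ d, x = ι d ∧ Crosses s (fun d => c (ι d)) T d := by
  constructor
  · intro hx
    rcases C.cases x with h1 | ⟨d, rfl⟩
    · exact absurd hx.2.1 (by
        have := hx.2.2
        rwa [Set.mem_preimage, h1] at this)
    · refine ⟨d, rfl, hx.1, ?_, ?_⟩
      · have := hx.2.1
        rwa [Set.mem_preimage, C.proj] at this
      · have := hx.2.2
        rwa [C.rot, Set.mem_preimage, C.proj] at this
  · rintro ⟨d, rfl, h1, h2, h3⟩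
    refine ⟨h1, ?_, ?_⟩
    · rwa [Set.mem_preimage, C.proj]
    · rwa [C.rot, Set.mem_preimage, C.proj]

/-- A circuit misses one of the ten parts of a graph that contracts to the Petersen graph. -/
theorem CircuitLike.exists_missed {π : U → PetersenVertex} {ι : PetersenVertex × Fin 3 → U × Fin 3}
    (hN : CircuitLike R c N) (C : Contraction R petersenRot π ι) : ∃ p, ∀ x ∈ N, π x ≠ p := by
  by_contra! hmeet
  -- The circuit meets every part and is not contained in any, so it leaves each part by a positive
  -- even number of the three edges, that is, by exactly two. In the contraction it thus becomes a
  -- 2-factor, whose closed pentagon contradicts connectedness.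
  have h2 : ∀ x, ∃ i, ∀ j, c (ι (x, j)) ↔ j ≠ i := by
    intro x
    have hset : {d | Crosses R c (π ⁻¹' {x}) d} =
        (fun j => ι (x, j)) '' {j | c (ι (x, j))} := by
      ext d
      simp only [Set.mem_ofPred_eq, C.crosses_preimage, Set.mem_image]
      constructor
      · rintro ⟨⟨y, j⟩, rfl, h1, h2, h3⟩
        obtain rfl : y = x := h2
        exact ⟨j, h1, rfl⟩
      · rintro ⟨j, h1, rfl⟩
        exact ⟨_, rfl, h1, rfl, petersenRot_fst_ne (x, j)⟩
    have heven := hN.even (π ⁻¹' {x})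
    rw [hset, Set.ncard_image_of_injective _ (fun a b hab => congrArg Prod.snd (C.inj hab))]
      at heven
    have hne : {j | c (ι (x, j))}.Nonempty := by
      obtain ⟨a, ha, hax⟩ := hmeet x
      obtain ⟨y, hyx⟩ : ∃ y, y ≠ x := ⟨_, petersenRot_fst_ne (x, 0)⟩
      obtain ⟨b, hb, hby⟩ := hmeet y
      obtain ⟨d, hd⟩ := hN.conn (π ⁻¹' {x}) ⟨a, ha, hax⟩ ⟨b, hb, by
        intro h; exact hyx (hby.symm.trans h)⟩
      have h3 : d ∈ {d | Crosses R c (π ⁻¹' {x}) d} := hd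
      rw [hset] at h3
      obtain ⟨j, hj, -⟩ := h3
      exact ⟨j, hj⟩
    classical
    have hfin : ∀ S : Finset (Fin 3), Even S.card → S.Nonempty → ∃ i, ∀ j, j ∈ S ↔ j ≠ i := by
      decide
    obtain ⟨i, hi⟩ := hfin (Finset.univ.filter fun j => c (ι (x, j)))
      (by
        rw [← Set.ncard_coe_finset]
        convert heven using 2
        ext; simp)
      (by obtain ⟨j, hj⟩ := hne; exact ⟨j, by simpa using hj⟩)
    exact ⟨i, fun j => by simpa using hi j⟩
  obtain ⟨S, hodd, hroot, hS⟩ := petersen_two_factor (fun d => c (ι d))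
    (fun d => by rw [← C.rot, hN.symm]) h2
  have hne : S.Nonempty := by
    rw [Set.nonempty_iff_ne_empty]
    rintro rfl
    simp at hodd
  obtain ⟨p, hp⟩ := hne
  obtain ⟨a, ha, hap⟩ := hmeet p
  obtain ⟨b, hb, hbr⟩ := hmeet petersenRoot
  obtain ⟨d, hd⟩ := hN.conn (π ⁻¹' S) ⟨a, ha, by rwa [Set.mem_preimage, hap]⟩
    ⟨b, hb, by rwa [Set.mem_preimage, hbr]⟩
  obtain ⟨e, rfl, h3⟩ := (C.crosses_preimage S d).1 hd
  exact h3.2.2 (hS e h3.1 h3.2.1)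

/-- `ReachFrom R h N u n`: some walk along `h` leads from `N` to `u` and has `n` branch vertices
after its first vertex. -/
inductive ReachFrom (R : U × Fin 3 → U × Fin 3) (h : U × Fin 3 → Prop) (N : Set U) : U → ℕ → Prop
  | start {u : U} : u ∈ N → ReachFrom R h N u 0
  | step {u : U} {n : ℕ} (i : Fin 3) : ReachFrom R h N u n → h (u, i) →
      ReachFrom R h N (R (u, i)).1 (n + branchCost h (R (u, i)).1)

end Circuits

/-- Some branch vertex is far away from the given circuit. -/
theorem CutGood.exists_far_branch {n : ℕ} (hn : 2 ≤ n) {h c : IterVertex n × Fin 3 → Prop}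
    {N : Set (IterVertex n)} (hc : CutGood (iterRot n) h) (hN : CircuitLike (iterRot n) c N) :
    ∃ x, IsBranch h x ∧ ∀ k, ReachFrom (iterRot n) h N x k → 2 ^ (2 * n - 3) ≤ k := by
  obtain ⟨i, rfl⟩ : ∃ i, n = i + 2 := ⟨n - 2, by omega⟩
  obtain ⟨π, ι, C, hcι, hcb⟩ := exists_contraction_crossBound (i + 2) hc i 1 (by omega)
  change IterVertex (i + 2) → PetersenVertex × PVertex at π
  change (PetersenVertex × PVertex) × Fin 3 → _ at ι
  change Contraction (iterRot (i + 2)) (inflateRot petersenRot) π ι at C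
  have hrot := isRot_iterRot (i + 2)
  obtain ⟨p, hp⟩ := hN.exists_missed C.comp_inflate
  set m := 4 ^ i with hm
  have hm1 : 1 ≤ m := Nat.one_le_pow _ _ (by decide)
  -- The edge 1 is the only one at depth 1. Choosing `t₂ ≠ 1` makes the branch vertex below
  -- expensive to reach from that edge.
  have hport : ∃ t₂, t₂ ≠ 1 ∧ h (ι ((p, petersenFar), t₂)) := by
    obtain ⟨a, b, hab, ha, hb⟩ := hcι.exists_two (p, petersenFar)
    by_cases ha1 : a = 1
    · exact ⟨b, fun hb1 => hab (ha1.trans hb1.symm), hb⟩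
    · exact ⟨a, ha1, ha⟩
  obtain ⟨t₂, ht₂, hht₂⟩ := hport
  obtain ⟨x, hxw, hxb, hx⟩ := hcb.exists_branch C (isRot_petersenRot.inflate).loopless
    hrot.invol hc hm1 (p, petersenFar) t₂ hht₂
  refine ⟨x, hxb, fun k hk => ?_⟩
  -- The walk starts outside the missed part `p`, so the bound is vacuous at first. It is
  -- established anew each time the walk enters the part.
  have key : ∀ u k, ReachFrom (iterRot (i + 2)) h N u k →
      LowerBound (iterRot (i + 2)) h π ι m petersenDepth p u k := by
    intro u k hu
    induction hu with
    | start hu =>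
      intro q hq
      exact absurd (congrArg Prod.fst hq) (hp _ hu)
    | @step u k j hu h1 ih =>
      by_cases hup : (π u).1 = p
      · exact ih.step isRot_petersenRot hcb isPotential_petersenDepth C hc.symm j hup h1
      · exact LowerBound.enter isPotential_petersenDepth petersenDepth_root C hc.symm j hup h1
  obtain ⟨t, n', h1, h2, h3⟩ := key x k hk _ hxw
  rw [petersenDepth_far] at h3
  have hpow : 2 ^ (2 * (i + 2) - 3) = 2 * m := by
    rw [show 2 * (i + 2) - 3 = 2 * i + 1 by omega, pow_succ, pow_mul, hm]
    norm_num [mul_comm]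
  rw [hpow]
  -- Entry through edge 1 costs `m` before the subpart and another `m` inside it. Entry through any
  -- other edge has already cost `2 * m`.
  by_cases ht : t = 1
  · subst ht
    have := hx 1 (Ne.symm ht₂) h1 n' h2
    simp at h3
    omega
  · rw [if_neg ht] at h3
    omega

/-! ### Connectivity of the iterated Petersen graphs -/

section ThreeConnected

variable {V : Type} {r : V × Fin 3 → V × Fin 3}

/-- A two-colouring that is constant along the edges avoiding two given vertices is constant
outside these two vertices. -/
def ConnectedOffPairs (r : V × Fin 3 → V × Fin 3) : Prop :=
  ∀ (a b : V) (f : V → Bool),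
    (∀ d : V × Fin 3, d.1 ≠ a → d.1 ≠ b → (r d).1 ≠ a → (r d).1 ≠ b → f (r d).1 = f d.1) →
    ∀ x y, x ≠ a → x ≠ b → y ≠ a → y ≠ b → f x = f y

/-- Add to a list of vertices of the Petersen graph all their neighbours other than `a`, `b`. -/
def petersenGrow (a b : PetersenVertex) (l : List PetersenVertex) : List PetersenVertex :=
  (l ++ (l.flatMap fun x => [(petersenRot (x, 0)).1, (petersenRot (x, 1)).1,
    (petersenRot (x, 2)).1]).filter fun y => y != a && y != b).dedup

theorem petersenGrow_spec {a b : PetersenVertex} {f : PetersenVertex → Bool}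
    (hf : ∀ d : PetersenVertex × Fin 3, d.1 ≠ a → d.1 ≠ b → (petersenRot d).1 ≠ a →
      (petersenRot d).1 ≠ b → f (petersenRot d).1 = f d.1) {x : PetersenVertex}
    {l : List PetersenVertex} (hl : ∀ y ∈ l, y ≠ a ∧ y ≠ b ∧ f y = f x) :
    ∀ y ∈ petersenGrow a b l, y ≠ a ∧ y ≠ b ∧ f y = f x := by
  intro y hy
  unfold petersenGrow at hy
  rw [List.mem_dedup, List.mem_append] at hy
  rcases hy with hy | hy
  · exact hl y hy
  · rw [List.mem_filter, List.mem_flatMap] at hy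
    obtain ⟨⟨z, hz, hyz⟩, hab⟩ := hy
    obtain ⟨hza, hzb, hzx⟩ := hl z hz
    have hya : y ≠ a ∧ y ≠ b := by simpa using hab
    refine ⟨hya.1, hya.2, ?_⟩
    rw [← hzx]
    simp only [List.mem_cons, List.not_mem_nil, or_false] at hyz
    rcases hyz with rfl | rfl | rfl <;> exact hf _ hza hzb hya.1 hya.2

set_option synthInstance.maxSize 1000 in
set_option synthInstance.maxHeartbeats 400000 in
theorem petersenGrow_complete : ∀ a b : PetersenVertex, ∃ x, x ≠ a ∧ x ≠ b ∧
    ∀ y, y ≠ a → y ≠ b →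
    y ∈ petersenGrow a b (petersenGrow a b (petersenGrow a b [x])) := by
  decide +kernel

/-- After deletion of any two vertices there is a vertex from which three rounds of adding
neighbours reach all the rest; colours are constant along this growth. -/
theorem connectedOffPairs_petersenRot : ConnectedOffPairs petersenRot := by
  intro a b f hf x y hxa hxb hya hyb
  obtain ⟨z, hza, hzb, hz⟩ := petersenGrow_complete a b
  have h0 : ∀ y ∈ [z], y ≠ a ∧ y ≠ b ∧ f y = f z := by simp [hza, hzb]
  have key : ∀ y, y ≠ a → y ≠ b → f y = f z := fun y hya hyb =>
    (petersenGrow_spec hf (petersenGrow_spec hf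
      (petersenGrow_spec hf h0)) y (hz y hya hyb)).2.2
  rw [key x hxa hxb, key y hya hyb]

theorem inflateEnd_fst_ne {d : V × Fin 3} {v : V} (hd : d.1 ≠ v) (p : PVertex) :
    (inflateEnd d).1 ≠ (v, p) := fun h => hd (congrArg Prod.fst h)

/-- Of the three edges at `v`, at most one leads to `w` and at most one starts at the vertex `x` of
the inflated graph. -/
theorem exists_end_avoiding (hr : IsRot r) (v w : V) (x : V × PVertex) :
    ∃ j, (r (v, j)).1 ≠ w ∧ (inflateEnd (v, j)).1 ≠ x := by
  by_contra! hcon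
  have h1 : ∀ i j, (r (v, i)).1 = w → (r (v, j)).1 = w → i = j := fun i j hi hj =>
    hr.simple v i j (hi.trans hj.symm)
  have h2 : ∀ i j, (inflateEnd (v, i)).1 = x → (inflateEnd (v, j)).1 = x → i = j :=
    fun i j hi hj => petersenRot_fst_inj _ _ _
      (congrArg (fun y : V × PVertex => y.2.1) (hi.trans hj.symm))
  have h3 : ∀ j, (r (v, j)).1 = w ∨ (inflateEnd (v, j)).1 = x := fun j => by
    by_cases h : (r (v, j)).1 = w
    · exact Or.inl h
    · exact Or.inr (hcon j h)
  rcases h3 0 with a | a <;> rcases h3 1 with b | b <;> rcases h3 2 with c | c <;>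
  first
  | exact absurd (h1 _ _ a b) (by decide)
  | exact absurd (h1 _ _ a c) (by decide)
  | exact absurd (h1 _ _ b c) (by decide)
  | exact absurd (h2 _ _ a b) (by decide)
  | exact absurd (h2 _ _ a c) (by decide)
  | exact absurd (h2 _ _ b c) (by decide)

/-- The undamaged copies of `P` are joined to each other because `r` is connected off pairs. If the
deleted vertices lie in one copy, the rest of the graph acts as the root of a Petersen graph with
two vertices deleted. If they lie in different copies, each damaged copy is a Petersen graph minus
two vertices, hence connected, and keeps an edge to an undamaged copy. -/
theorem ConnectedOffPairs.inflate (hr : IsRot r) (hcon : ConnectedOffPairs r) :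
    ConnectedOffPairs (inflateRot r) := by
  rintro ⟨v₁, p₁⟩ ⟨v₂, p₂⟩ f hf
  have hfib : ∀ v x₀, (∀ p : PVertex, p.1 ≠ x₀ → (v, p) ≠ (v₁, p₁) ∧ (v, p) ≠ (v₂, p₂)) →
      ∀ p q : PVertex, p.1 ≠ x₀ → q.1 ≠ x₀ → f (v, p) = f (v, q) := by
    intro v x₀ hx₀ p q hp hq
    have := connectedOffPairs_petersenRot petersenRoot x₀
      (fun x => if hx : x = petersenRoot then false else f (v, ⟨x, hx⟩)) (by
        rintro ⟨x, i⟩ h1 h2 h3 h4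
        dsimp only at h1 h2 ⊢
        rw [dif_neg h1, dif_neg h3]
        have h5 := inflateRot_of_ne_root (r := r) v ⟨x, h1⟩ i h3
        have h6 := hf ((v, ⟨x, h1⟩), i) (hx₀ _ h2).1 (hx₀ _ h2).2
        rw [h5] at h6
        exact h6 (hx₀ _ h4).1 (hx₀ _ h4).2) p.1 q.1 p.2 hp q.2 hq
    simpa [p.2, q.2] using this
  suffices hsuff : ∃ col, ∀ x : V × PVertex, x ≠ (v₁, p₁) → x ≠ (v₂, p₂) → f x = col by
    obtain ⟨col, hcol⟩ := hsuff
    intro x y h1 h2 h3 h4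
    rw [hcol x h1 h2, hcol y h3 h4]
  -- In an undamaged copy nothing need be excluded besides the root, so the root is used as both
  -- members of the deleted pair.
  have hmono : ∀ v, v ≠ v₁ → v ≠ v₂ → ∀ p q, f (v, p) = f (v, q) := fun v h1 h2 p q =>
    hfib v petersenRoot (fun p _ => ⟨fun h => h1 (congrArg Prod.fst h),
      fun h => h2 (congrArg Prod.fst h)⟩) p q p.2 q.2
  have q₀ : PVertex := petersenFar
  have hoff : ∀ v w, v ≠ v₁ → v ≠ v₂ → w ≠ v₁ → w ≠ v₂ → ∀ p q, f (v, p) = f (w, q) := by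
    intro v w h1 h2 h3 h4 p q
    have := hcon v₁ v₂ (fun v => f (v, q₀)) (by
      intro d h1 h2 h3 h4
      have h5 := hf (inflateEnd d) (fun h => h1 (congrArg Prod.fst h))
        (fun h => h2 (congrArg Prod.fst h))
      rw [inflateRot_inflateEnd] at h5
      have h6 := h5 (fun h => h3 (congrArg Prod.fst h)) (fun h => h4 (congrArg Prod.fst h))
      rw [hmono _ h1 h2 q₀ (inflateEnd d).1.2, hmono _ h3 h4 q₀ (inflateEnd (r d)).1.2]
      exact h6) v w h1 h2 h3 h4
    rw [hmono v h1 h2 p q₀, hmono w h3 h4 q q₀]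
    exact this
  by_cases hv : v₁ = v₂
  · subst hv
    have hw := hr.loopless (v₁, 0)
    refine ⟨f ((r (v₁, 0)).1, q₀), ?_⟩
    have hloc := connectedOffPairs_petersenRot p₁.1 p₂.1
      (fun x => if hx : x = petersenRoot then f ((r (v₁, 0)).1, q₀) else f (v₁, ⟨x, hx⟩)) (by
        rintro ⟨x, i⟩ h1 h2 h3 h4
        dsimp only at h1 h2 ⊢
        by_cases hx : x = petersenRoot
        · subst hx
          rw [dif_pos rfl, dif_neg (petersenRot_root_ne i)]
          have h5 := hf (inflateEnd (r (v₁, i)))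
            (inflateEnd_fst_ne (hr.loopless (v₁, i)) _)
            (inflateEnd_fst_ne (hr.loopless (v₁, i)) _)
          rw [inflateRot_inflateEnd, hr.invol] at h5
          have h6 := h5 (fun h => h3 (congrArg (fun y => y.2.1) h))
            (fun h => h4 (congrArg (fun y => y.2.1) h))
          rw [hoff _ _ hw hw (hr.loopless (v₁, i)) (hr.loopless (v₁, i)) q₀
            (inflateEnd (r (v₁, i))).1.2]
          exact h6
        · rw [dif_neg hx]
          have hne1 : ((v₁, ⟨x, hx⟩) : V × PVertex) ≠ (v₁, p₁) := fun h =>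
            h1 (congrArg (fun y : V × PVertex => y.2.1) h)
          have hne2 : ((v₁, ⟨x, hx⟩) : V × PVertex) ≠ (v₁, p₂) := fun h =>
            h2 (congrArg (fun y : V × PVertex => y.2.1) h)
          by_cases hy : (petersenRot (x, i)).1 = petersenRoot
          · rw [dif_pos hy]
            have h5 := hf ((v₁, ⟨x, hx⟩), i) hne1 hne2
            rw [inflateRot_of_eq_root v₁ ⟨x, hx⟩ i hy] at h5
            have hl := hr.loopless (v₁, (petersenRot (x, i)).2)
            have h6 := h5 (inflateEnd_fst_ne hl _) (inflateEnd_fst_ne hl _)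
            rw [← h6]
            exact hoff _ _ hw hw hl hl _ _
          · rw [dif_neg hy]
            have h5 := hf ((v₁, ⟨x, hx⟩), i) hne1 hne2
            rw [inflateRot_of_ne_root v₁ ⟨x, hx⟩ i hy] at h5
            exact h5 (fun h => h3 (congrArg (fun y : V × PVertex => y.2.1) h))
              (fun h => h4 (congrArg (fun y : V × PVertex => y.2.1) h)))
    rintro ⟨v, p⟩ h1 h2
    by_cases hvv : v = v₁
    · subst hvv
      have := hloc p.1 petersenRoot (fun h => h1 (by rw [Subtype.ext h]))
        (fun h => h2 (by rw [Subtype.ext h])) p₁.2.symm p₂.2.symm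
      simpa [p.2] using this
    · exact hoff _ _ hvv hvv hw hw _ _
  · have hm1 : ∀ p q, p ≠ p₁ → q ≠ p₁ → f (v₁, p) = f (v₁, q) := fun p q hp hq =>
      hfib v₁ p₁.1 (fun p hp => ⟨fun h => hp (congrArg (fun y : V × PVertex => y.2.1) h),
        fun h => hv (congrArg Prod.fst h)⟩) p q (fun h => hp (Subtype.ext h))
        (fun h => hq (Subtype.ext h))
    have hm2 : ∀ p q, p ≠ p₂ → q ≠ p₂ → f (v₂, p) = f (v₂, q) := fun p q hp hq =>
      hfib v₂ p₂.1 (fun p hp => ⟨fun h => hv (congrArg Prod.fst h).symm,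
        fun h => hp (congrArg (fun y : V × PVertex => y.2.1) h)⟩) p q (fun h => hp (Subtype.ext h))
        (fun h => hq (Subtype.ext h))
    obtain ⟨j₁, hj₁, hj₁'⟩ := exists_end_avoiding hr v₁ v₂ (v₁, p₁)
    obtain ⟨j₂, hj₂, hj₂'⟩ := exists_end_avoiding hr v₂ v₁ (v₂, p₂)
    have hl1 := hr.loopless (v₁, j₁)
    have hl2 := hr.loopless (v₂, j₂)
    refine ⟨f ((r (v₁, j₁)).1, q₀), ?_⟩
    rintro ⟨v, p⟩ h1 h2
    by_cases hv1 : v = v₁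
    · subst hv1
      have h5 := hf (inflateEnd (v, j₁)) hj₁' (fun h => hv (congrArg Prod.fst h))
      rw [inflateRot_inflateEnd] at h5
      have h6 := h5 (inflateEnd_fst_ne hl1 _) (fun h => hj₁ (congrArg Prod.fst h))
      rw [hm1 p (inflateEnd (v, j₁)).1.2 (fun h => h1 (by rw [h]))
        (fun h => hj₁' (Prod.ext rfl h)), hoff _ _ hl1 hj₁ hl1 hj₁ q₀ (inflateEnd (r (v, j₁))).1.2]
      exact h6.symm
    · by_cases hv2 : v = v₂
      · subst hv2
        have h5 := hf (inflateEnd (v, j₂)) (fun h => hv1 (congrArg Prod.fst h)) hj₂'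
        rw [inflateRot_inflateEnd] at h5
        have h6 := h5 (fun h => hj₂ (congrArg Prod.fst h)) (inflateEnd_fst_ne hl2 _)
        rw [hm2 p (inflateEnd (v, j₂)).1.2 (fun h => h2 (by rw [h]))
          (fun h => hj₂' (Prod.ext rfl h)),
          hoff _ _ hl1 hj₁ hj₂ hl2 q₀ (inflateEnd (r (v, j₂))).1.2]
        exact h6.symm
      · exact hoff _ _ hv1 hv2 hl1 hj₁ _ _

theorem connectedOffPairs_iterRot : ∀ k, ConnectedOffPairs (iterRot k)
  | 0 => connectedOffPairs_petersenRot
  | k + 1 => ConnectedOffPairs.inflate (V := IterVertex k) (isRot_iterRot k)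
      (connectedOffPairs_iterRot k)

end ThreeConnected

/-! ### Basic properties of the iterated Petersen graphs -/

instance finite_iterVertex : ∀ k, Finite (IterVertex k)
  | 0 => inferInstanceAs (Finite PetersenVertex)
  | k + 1 => by
    have : Finite (IterVertex k) := finite_iterVertex k
    exact inferInstanceAs (Finite (IterVertex k × PVertex))

theorem card_iterVertex : ∀ k, Nat.card (IterVertex k) = 10 * 9 ^ k
  | 0 => by
    change Nat.card PetersenVertex = _
    rw [Nat.card_eq_fintype_card]; decide
  | k + 1 => by
    change Nat.card (IterVertex k × PVertex) = _
    rw [Nat.card_prod, card_pVertex, card_iterVertex k]; ring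

theorem iteratedPetersen_isLink {k : ℕ} {e : Sym2 (IterVertex k)} {x y : IterVertex k} :
    (iteratedPetersen k).IsLink e x y ↔ e = s(x, y) ∧ ∃ i, (iterRot k (x, i)).1 = y := by
  have hrot := isRot_iterRot k
  simp only [iteratedPetersen, ofSimpleGraph_isLink]
  constructor
  · rintro ⟨rfl, h⟩
    rw [SimpleGraph.mem_edgeSet, SimpleGraph.fromRel_adj] at h
    rcases h with ⟨-, h | ⟨i, h⟩⟩
    · exact ⟨rfl, h⟩
    · refine ⟨rfl, (iterRot k (y, i)).2, ?_⟩
      rw [← h, Prod.mk.eta, hrot.invol]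
  · rintro ⟨rfl, i, h⟩
    refine ⟨rfl, ?_⟩
    rw [SimpleGraph.mem_edgeSet, SimpleGraph.fromRel_adj]
    exact ⟨fun hxy => hrot.loopless (x, i) (h.trans hxy.symm), Or.inl ⟨i, h⟩⟩

@[simp] theorem vertexSet_iteratedPetersen (k : ℕ) : V(iteratedPetersen k) = Set.univ := rfl

theorem isFiniteGraph_iteratedPetersen (k : ℕ) : (iteratedPetersen k).IsFiniteGraph :=
  ⟨Set.toFinite _, Set.toFinite _⟩

theorem isCubic_iteratedPetersen (k : ℕ) : (iteratedPetersen k).IsCubic := by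
  intro x _
  have hrot := isRot_iterRot k
  have h1 : (iteratedPetersen k).loopSet x = ∅ := by
    ext e
    simp only [mem_loopSet, ← isLink_self_iff, iteratedPetersen_isLink, Set.mem_empty_iff_false,
      iff_false, not_and, not_exists]
    exact fun _ i => hrot.loopless (x, i)
  have h2 : (iteratedPetersen k).incidenceSet x =
      (fun i => s(x, (iterRot k (x, i)).1)) '' Set.univ := by
    ext e
    simp only [mem_incidenceSet, Inc, iteratedPetersen_isLink, Set.image_univ, Set.mem_range]
    constructor
    · rintro ⟨y, rfl, i, rfl⟩; exact ⟨i, rfl⟩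
    · rintro ⟨i, rfl⟩; exact ⟨_, rfl, i, rfl⟩
  have h3 : Function.Injective fun i => s(x, (iterRot k (x, i)).1) := fun i j hij =>
    hrot.simple x i j (Sym2.congr_right.1 hij)
  rw [valency, h1, h2, h3.encard_image, Set.encard_univ]
  simp

theorem not_isIsomorphic_iteratedPetersen {j k : ℕ} (hjk : j ≠ k) :
    ¬ (iteratedPetersen j).IsIsomorphic (iteratedPetersen k) := by
  rintro ⟨φ, -⟩
  have h1 := Nat.card_congr φ
  rw [vertexSet_iteratedPetersen, vertexSet_iteratedPetersen, Nat.card_congr (Equiv.Set.univ _),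
    Nat.card_congr (Equiv.Set.univ _), card_iterVertex, card_iterVertex] at h1
  exact hjk (Nat.pow_right_injective (by decide : 2 ≤ 9) (by
    have : 9 ^ j = 9 ^ k := by omega
    exact this))

theorem iterRot_color_const {k : ℕ} {X : Set (IterVertex k)} (hX : X.encard ≤ 2)
    (f : IterVertex k → Bool)
    (hf : ∀ d, d.1 ∉ X → (iterRot k d).1 ∉ X → f (iterRot k d).1 = f d.1)
    {x y : IterVertex k} (hx : x ∉ X) (hy : y ∉ X) : f x = f y := by
  have hrot := isRot_iterRot k
  have hpair : ∀ a b, X ⊆ {a, b} → x ∉ ({a, b} : Set _) → y ∉ ({a, b} : Set _) → f x = f y := by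
    intro a b hab hxab hyab
    simp only [Set.mem_insert_iff, Set.mem_singleton_iff, not_or] at hxab hyab
    refine connectedOffPairs_iterRot k a b f (fun d h1 h2 h3 h4 => hf d ?_ ?_) x y hxab.1 hxab.2
      hyab.1 hyab.2
    · exact fun h => (hab h).elim h1 h2
    · exact fun h => (hab h).elim h3 h4
  rcases X.eq_empty_or_nonempty with rfl | ⟨a, ha⟩
  -- If nothing is deleted, any vertex other than `x` and `y` may be deleted in addition.
  · have : ∃ a, a ≠ x ∧ a ≠ y := by
      by_cases h0 : (iterRot k (x, 0)).1 = y
      · refine ⟨(iterRot k (x, 1)).1, hrot.loopless (x, 1), fun h1 => ?_⟩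
        exact absurd (hrot.simple x 0 1 (h0.trans h1.symm)) (by decide)
      · exact ⟨_, hrot.loopless (x, 0), h0⟩
    obtain ⟨a, hax, hay⟩ := this
    exact hpair a a (Set.empty_subset _) (by simp [hax.symm]) (by simp [hay.symm])
  · by_cases hb : ∃ b ∈ X, b ≠ a
    · obtain ⟨b, hbX, hba⟩ := hb
      have hXab : X = {a, b} := by
        refine ((Set.toFinite _).eq_of_subset_of_encard_le (Set.pair_subset ha hbX) ?_).symm
        rwa [Set.encard_pair hba.symm]
      exact hpair a b hXab.subset (hXab ▸ hx) (hXab ▸ hy)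
    · push Not at hb
      have hXa : X = {a, a} := by
        ext z; simp only [Set.mem_insert_iff, Set.mem_singleton_iff, or_self]
        exact ⟨hb z, fun h => h ▸ ha⟩
      exact hpair a a hXa.subset (hXa ▸ hx) (hXa ▸ hy)

theorem isThreeConnected_iteratedPetersen (k : ℕ) : (iteratedPetersen k).IsThreeConnected := by
  have hcard : (4 : ℕ∞) ≤ (Set.univ : Set (IterVertex k)).encard := by
    rw [← (Set.toFinite Set.univ).cast_ncard_eq, Set.ncard_univ, card_iterVertex]
    have : 1 ≤ 9 ^ k := Nat.one_le_pow _ _ (by decide)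
    exact_mod_cast (by omega : 4 ≤ 10 * 9 ^ k)
  refine ⟨hcard, fun X hX => ?_⟩
  have hne : ∃ x, x ∉ X := by
    by_contra! hall
    rw [Set.eq_univ_of_forall hall] at hX
    exact absurd (hcard.trans hX) (by decide)
  obtain ⟨x₀, hx₀⟩ := hne
  have hmem : ∀ x, x ∉ X → x ∈ V((iteratedPetersen k).deleteVerts X) := fun x hx => by simpa
  have : Nonempty V((iteratedPetersen k).deleteVerts X) := ⟨⟨x₀, hmem x₀ hx₀⟩⟩
  refine SimpleGraph.Connected.mk fun x y => ?_
  classical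
  have hx : x.1 ∉ X := by simpa using x.2
  have hy : y.1 ∉ X := by simpa using y.2
  have := iterRot_color_const hX (fun z => decide (∃ hz : z ∉ X,
    ((iteratedPetersen k).deleteVerts X).toSimpleGraph.Reachable x ⟨z, hmem z hz⟩)) (by
      intro d h1 h2
      have hadj : ((iteratedPetersen k).deleteVerts X).toSimpleGraph.Adj ⟨d.1, hmem _ h1⟩
          ⟨(iterRot k d).1, hmem _ h2⟩ := by
        refine ⟨fun h => (isRot_iterRot k).loopless d (congrArg Subtype.val h).symm, ?_⟩
        exact ⟨s(d.1, (iterRot k d).1), by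
          rw [deleteVerts_isLink, iteratedPetersen_isLink]
          exact ⟨⟨rfl, d.2, rfl⟩, h1, h2⟩⟩
      simp only [decide_eq_decide]
      exact ⟨fun ⟨_, h⟩ => ⟨h1, h.trans hadj.symm.reachable⟩,
        fun ⟨_, h⟩ => ⟨h2, h.trans hadj.reachable⟩⟩) hx hy
  have h2 : ∃ hz : x.1 ∉ X,
    ((iteratedPetersen k).deleteVerts X).toSimpleGraph.Reachable x ⟨x.1, hmem x.1 hz⟩ :=
      ⟨hx, SimpleGraph.Reachable.refl _⟩
  simp only [decide_eq_decide] at this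
  exact (this.1 h2).2

universe u v u' v'

variable {α : Type u} {β : Type v} {α' : Type u'} {β' : Type v'}

/-! ### Cuts of multigraphs -/

/-- The edges of `G` with exactly one end in `S`. -/
def cutEdges (G : Graph α β) (S : Set α) : Set β := {e | ∃ x y, G.IsLink e x y ∧ x ∈ S ∧ y ∉ S}

theorem IsLink.mem_cutEdges {G : Graph α β} {e : β} {x y : α} (h : G.IsLink e x y) (S : Set α) :
    e ∈ G.cutEdges S ↔ ¬ (x ∈ S ↔ y ∈ S) := by
  constructor
  · rintro ⟨a, b, hab, ha, hb⟩
    rcases h.eq_and_eq_or_eq_and_eq hab with ⟨rfl, rfl⟩ | ⟨rfl, rfl⟩ <;> tauto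
  · intro hxy
    by_cases hx : x ∈ S
    · exact ⟨x, y, h, hx, by tauto⟩
    · exact ⟨y, x, h.symm, by tauto, hx⟩

theorem cutEdges_subset (G : Graph α β) (S : Set α) : G.cutEdges S ⊆ E(G) := by
  rintro e ⟨x, y, h, -⟩; exact h.edge_mem

theorem cutEdges_compl (G : Graph α β) (S : Set α) : G.cutEdges Sᶜ = G.cutEdges S := by
  ext e
  constructor <;>
  · rintro ⟨x, y, h, hx, hy⟩
    exact ⟨y, x, h.symm, by simpa using hy, by simpa using hx⟩

theorem IsConnectedGraph.cutEdges_nonempty {G : Graph α β} (hG : G.IsConnectedGraph) {S : Set α}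
    {x y : α} (hx : x ∈ V(G)) (hy : y ∈ V(G)) (hxS : x ∈ S) (hyS : y ∉ S) :
    (G.cutEdges S).Nonempty := by
  obtain ⟨p⟩ := hG.preconnected ⟨x, hx⟩ ⟨y, hy⟩
  have key : ∀ {a b : V(G)}, G.toSimpleGraph.Walk a b → a.1 ∈ S → b.1 ∉ S →
      (G.cutEdges S).Nonempty := by
    intro a b p
    induction p with
    | nil => intro h1 h2; exact absurd h1 h2
    | @cons a b c hadj p ih =>
      intro h1 h2
      by_cases hb : b.1 ∈ S
      · exact ih hb h2
      · obtain ⟨-, e, he⟩ := hadj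
        exact ⟨e, a, b, he, h1, hb⟩
  exact key p hxS hyS

theorem isConnectedGraph_of_cutEdges_nonempty {G : Graph α β} (hne : V(G).Nonempty)
    (hG : ∀ (S : Set α) (x y : α), x ∈ V(G) → y ∈ V(G) → x ∈ S → y ∉ S → (G.cutEdges S).Nonempty) :
    G.IsConnectedGraph := by
  obtain ⟨x₀, hx₀⟩ := hne
  have : Nonempty V(G) := ⟨⟨x₀, hx₀⟩⟩
  refine SimpleGraph.Connected.mk fun x y => ?_
  by_contra hxy
  obtain ⟨e, a, b, hab, ⟨ha, hxa⟩, hb⟩ := hG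
    {z | ∃ hz : z ∈ V(G), G.toSimpleGraph.Reachable x ⟨z, hz⟩} x y x.2 y.2
    ⟨x.2, SimpleGraph.Reachable.refl _⟩ (fun ⟨_, h⟩ => hxy h)
  apply hb
  refine ⟨hab.right_mem, ?_⟩
  by_cases heq : a = b
  · subst heq; exact hxa
  · exact hxa.trans (SimpleGraph.Adj.reachable (G := G.toSimpleGraph)
      ⟨fun h => heq (congrArg Subtype.val h), e, hab⟩)

/-- Every edge of a cut is accompanied by another edge of this cut. -/
def NoBridge (G : Graph α β) : Prop :=
  ∀ S, ∀ e ∈ G.cutEdges S, ∃ e' ∈ G.cutEdges S, e' ≠ e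

theorem IsTwoConnected.noBridge {G : Graph α β} (hG : G.IsTwoConnected) : G.NoBridge := by
  rintro S e ⟨x, y, he, hx, hy⟩
  obtain ⟨f, a, b, hab, ha, hb⟩ := (hG.2.2.2 e he.edge_mem).cutEdges_nonempty
    (x := x) (y := y) (S := S) he.left_mem he.right_mem hx hy
  rw [deleteEdges_isLink] at hab
  exact ⟨f, ⟨a, b, hab.1, ha, hb⟩, hab.2⟩

theorem even_ncard_symmDiff {A B : Set β} (hA : A.Finite) (hB : B.Finite) (hA' : Even A.ncard)
    (hB' : Even B.ncard) : Even (symmDiff A B).ncard := by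
  have h1 := Set.ncard_inter_add_ncard_sdiff_eq_ncard A B hA
  have h2 := Set.ncard_inter_add_ncard_sdiff_eq_ncard B A hB
  rw [Set.symmDiff_def, Set.ncard_union_eq (by
    rw [Set.disjoint_left]; rintro x ⟨h3, -⟩ ⟨-, h4⟩; exact h4 h3) (hA.subset Set.sdiff_subset)
    (hB.subset Set.sdiff_subset)]
  rw [Set.inter_comm] at h2
  rw [Nat.even_iff] at *
  omega

/-- Cuts add modulo two: adding a vertex to a set changes its cut by the symmetric difference with
the cut of that vertex. So single vertices suffice. -/
theorem IsCircuit.even_cutEdges {C : Graph α β} (hC : C.IsCircuit) (S : Set α) :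
    Even (C.cutEdges S).ncard := by
  have hfin : ∀ S, (C.cutEdges S).Finite := fun S => hC.1.2.subset (C.cutEdges_subset S)
  have hsing : ∀ a, a ∈ V(C) → Even (C.cutEdges {a}).ncard := by
    intro a ha
    have hv := hC.2.2 a ha
    have hset : C.cutEdges {a} = C.incidenceSet a \ C.loopSet a := by
      ext e
      constructor
      · rintro ⟨x, y, h, rfl, hy⟩
        exact ⟨⟨y, h⟩, fun hl => hy (hl.eq_of_inc h.inc_right).symm⟩
      · rintro ⟨⟨y, h⟩, hl⟩
        exact ⟨a, y, h, rfl, fun hy => hl (by obtain rfl : y = a := hy; exact h)⟩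
    have hi : (C.incidenceSet a).Finite := hC.1.2.subset (C.incidenceSet_subset_edgeSet a)
    have hl : (C.loopSet a).Finite := hi.subset (C.loopSet_subset_incidenceSet a)
    rw [valency, ← hi.cast_ncard_eq, ← hl.cast_ncard_eq] at hv
    have hv' : (C.incidenceSet a).ncard + (C.loopSet a).ncard = 2 := by exact_mod_cast hv
    -- Incident edges and loops add up to two, so their difference, the number of edges leaving `a`,
    -- is even.
    rw [hset, Set.ncard_sdiff (C.loopSet_subset_incidenceSet a) hl, Nat.even_iff]
    omega
  have key : ∀ T : Set α, T.Finite → T ⊆ V(C) → Even (C.cutEdges T).ncard := by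
    intro T hT
    induction T, hT using Set.Finite.induction_on with
    | empty =>
      intro _
      have : C.cutEdges ∅ = ∅ := by ext e; simp [cutEdges]
      simp [this]
    | @insert a T ha hT ih =>
      intro hsub
      rw [Set.insert_subset_iff] at hsub
      have : C.cutEdges (insert a T) = symmDiff (C.cutEdges T) (C.cutEdges {a}) := by
        ext e
        by_cases he : e ∈ E(C)
        · obtain ⟨x, y, h⟩ := exists_isLink_of_mem_edgeSet he
          rw [Set.mem_symmDiff, h.mem_cutEdges, h.mem_cutEdges, h.mem_cutEdges]
          simp only [Set.mem_insert_iff, Set.mem_singleton_iff]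
          by_cases hx : x = a <;> by_cases hy : y = a <;> by_cases hxT : x ∈ T <;>
            by_cases hyT : y ∈ T <;> simp_all
        · have hn : ∀ S, e ∉ C.cutEdges S := fun S h => he (C.cutEdges_subset S h)
          simp [Set.mem_symmDiff, hn]
      rw [this]
      exact even_ncard_symmDiff (hfin _) (hfin _) (ih hsub.2) (hsing a hsub.1)
  have : C.cutEdges S = C.cutEdges (S ∩ V(C)) := by
    ext e
    constructor
    · rintro ⟨x, y, h, hx, hy⟩
      exact ⟨x, y, h, ⟨hx, h.left_mem⟩, fun h => hy h.1⟩
    · rintro ⟨x, y, h, hx, hy⟩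
      exact ⟨x, y, h, hx.1, fun h' => hy ⟨h', h.right_mem⟩⟩
  rw [this]
  exact key _ (hC.1.1.subset Set.inter_subset_right) Set.inter_subset_right

/-! ### Circuits and subdivisions -/

/-- The edge set `D` and the vertex set `N` behave like those of a circuit of `G`. -/
structure CircuitIn (G : Graph α β) (D : Set β) (N : Set α) : Prop where
  subset : D ⊆ E(G)
  finite : D.Finite
  ends : ∀ e ∈ D, ∀ x y, G.IsLink e x y → x ∈ N
  even : ∀ S, Even (G.cutEdges S ∩ D).ncard
  conn : ∀ S : Set α, (∃ x ∈ N, x ∈ S) → (∃ x ∈ N, x ∉ S) → (G.cutEdges S ∩ D).Nonempty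

theorem IsCircuit.circuitIn {C G : Graph α β} (hC : C.IsCircuit) (h : C ≤ G) :
    G.CircuitIn E(C) V(C) := by
  have hlink : ∀ e ∈ E(C), ∀ x y, G.IsLink e x y → C.IsLink e x y := fun e he x y hxy =>
    (h.isLink_iff he).2 hxy
  have hcut : ∀ S, G.cutEdges S ∩ E(C) = C.cutEdges S := by
    intro S
    ext e
    constructor
    · rintro ⟨⟨x, y, hxy, hx, hy⟩, he⟩
      exact ⟨x, y, hlink e he x y hxy, hx, hy⟩
    · rintro ⟨x, y, hxy, hx, hy⟩
      exact ⟨⟨x, y, hxy.mono h, hx, hy⟩, hxy.edge_mem⟩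
  refine ⟨h.edgeSet_mono, hC.1.2, fun e he x y hxy => (hlink e he x y hxy).left_mem, fun S => ?_,
    fun S => ?_⟩
  · rw [hcut]; exact hC.even_cutEdges S
  · rw [hcut]
    rintro ⟨x, hx, hxS⟩ ⟨y, hy, hyS⟩
    exact hC.2.1.cutEdges_nonempty hx hy hxS hyS

/-- `WReach G B N x k`: some walk of `G` leads from `N` to `x` and has at most `k` vertices in `B`
after its first vertex. -/
inductive WReach (G : Graph α β) (B N : Set α) : α → ℕ → Prop
  | start {x : α} : x ∈ N → WReach G B N x 0
  | free {x y : α} {k : ℕ} : WReach G B N x k → G.Adj x y → y ∉ B → WReach G B N y k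
  | pay {x y : α} {k : ℕ} : WReach G B N x k → G.Adj x y → WReach G B N y (k + 1)

/-- `G` has a circuit such that every vertex of a set `B`, which contains all branch vertices, is
joined to the circuit by a walk with fewer than `m` vertices in `B` after its first vertex. -/
def NearCircuit (G : Graph α β) (m : ℕ) : Prop :=
  ∃ (D : Set β) (N B : Set α), G.CircuitIn D N ∧ B ⊆ V(G) ∧
    (∀ x ∈ V(G), x ∉ B → ∃ f₁ f₂, ∀ f z, G.IsLink f x z → z ≠ x ∧ (f = f₁ ∨ f = f₂)) ∧
    ∀ x ∈ B, ∃ k < m, G.WReach B N x k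

/-! ### Subdividing an edge -/

section Subdivision

variable {G H : Graph α β} {e e₁ e₂ : β} {x y w : α}

/-- A cut containing exactly one of `e₁`, `e₂` separates `x` from `y`. In `G` it contains `e` and
hence a further edge, which survives the subdivision. -/
theorem NoBridge.subdivide (hG : G.NoBridge) (h : G.IsEdgeSubdivision H) : H.NoBridge := by
  obtain ⟨e, e₁, e₂, x, y, w, he, hw, hne, he₁, he₂, hV, hl⟩ := h
  have hold : ∀ {f}, f ≠ e → ∀ S, f ∈ G.cutEdges S → f ∈ H.cutEdges S := by
    rintro f hf S ⟨a, b, hab, ha, hb⟩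
    exact ⟨a, b, (hl f a b).2 (Or.inl ⟨hf, hab⟩), ha, hb⟩
  have hl₁ : H.IsLink e₁ x w := (hl _ _ _).2 (Or.inr (Or.inl ⟨rfl, rfl⟩))
  have hl₂ : H.IsLink e₂ w y := (hl _ _ _).2 (Or.inr (Or.inr ⟨rfl, rfl⟩))
  have hnew : ∀ {f}, f ≠ e → f ∈ E(G) → f ≠ e₁ ∧ f ≠ e₂ := fun hf hfG =>
    ⟨fun h => he₁ (h ▸ ⟨hfG, hf⟩), fun h => he₂ (h ▸ ⟨hfG, hf⟩)⟩
  intro S f hf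
  have hf' := hf
  obtain ⟨a, b, hab, ha, hb⟩ := hf
  rcases (hl f a b).1 hab with ⟨hfe, hG'⟩ | ⟨rfl, -⟩ | ⟨rfl, -⟩
  · obtain ⟨f', hf'S, hne'⟩ := hG S f ⟨a, b, hG', ha, hb⟩
    by_cases hf'e : f' = e
    · subst hf'e
      rw [he.mem_cutEdges] at hf'S
      obtain ⟨h1, h2⟩ := hnew hfe hG'.edge_mem
      by_cases hxw : x ∈ S ↔ w ∈ S
      · exact ⟨e₂, (hl₂.mem_cutEdges S).2 (by tauto), h2.symm⟩
      · exact ⟨e₁, (hl₁.mem_cutEdges S).2 hxw, h1.symm⟩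
    · exact ⟨f', hold hf'e S hf'S, hne'⟩
  · rw [hl₁.mem_cutEdges] at hf'
    by_cases hwy : w ∈ S ↔ y ∈ S
    · obtain ⟨f', hf'S, hne'⟩ := hG S e ((he.mem_cutEdges S).2 (by tauto))
      exact ⟨f', hold hne' S hf'S, (hnew hne' (G.cutEdges_subset S hf'S)).1⟩
    · exact ⟨e₂, (hl₂.mem_cutEdges S).2 hwy, hne.symm⟩
  · rw [hl₂.mem_cutEdges] at hf'
    by_cases hxw : x ∈ S ↔ w ∈ S
    · obtain ⟨f', hf'S, hne'⟩ := hG S e ((he.mem_cutEdges S).2 (by tauto))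
      exact ⟨f', hold hne' S hf'S, (hnew hne' (G.cutEdges_subset S hf'S)).2⟩
    · exact ⟨e₁, (hl₁.mem_cutEdges S).2 hxw, hne⟩

/-- Here `p`, `q`, `r` say that `x`, `w`, `y` lie on a given side of a cut. The path through `w`
changes sides with the same parity as the edge `e`. Removing `e` from `X` first allows for its name
being reused. -/
theorem even_ncard_subdivide {X Y : Set β} {p q r : Prop} (hXfin : X.Finite) (hX : Even X.ncard)
    (heX : e ∈ X ↔ ¬ (p ↔ r)) (h₁ : e₁ ∉ X \ {e}) (h₂ : e₂ ∉ X \ {e}) (hne : e₁ ≠ e₂)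
    (hmem : ∀ f, f ∈ Y ↔ f ∈ X \ {e} ∨ (f = e₁ ∧ ¬ (p ↔ q)) ∨ (f = e₂ ∧ ¬ (q ↔ r))) :
    Even Y.ncard := by
  have hdfin : (X \ {e}).Finite := hXfin.subset Set.sdiff_subset
  by_cases hpq : p ↔ q <;> by_cases hqr : q ↔ r
  · have : Y = X := by
      ext f
      rw [hmem, Set.sdiff_singleton_eq_self (by rw [heX]; tauto)]
      tauto
    rwa [this]
  · have : Y = insert e₂ (X \ {e}) := by
      ext f
      rw [hmem, Set.mem_insert_iff]
      tauto
    rwa [this, Set.ncard_insert_of_notMem h₂ hdfin,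
      Set.ncard_sdiff_singleton_add_one (heX.2 (by tauto)) hXfin]
  · have : Y = insert e₁ (X \ {e}) := by
      ext f
      rw [hmem, Set.mem_insert_iff]
      tauto
    rwa [this, Set.ncard_insert_of_notMem h₁ hdfin,
      Set.ncard_sdiff_singleton_add_one (heX.2 (by tauto)) hXfin]
  · have hXe : X \ {e} = X := Set.sdiff_singleton_eq_self (by rw [heX]; tauto)
    have : Y = insert e₁ (insert e₂ (X \ {e})) := by
      ext f
      rw [hmem, Set.mem_insert_iff, Set.mem_insert_iff]
      tauto
    rw [this, Set.ncard_insert_of_notMem (by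
      rintro (h | h)
      · exact hne h
      · exact h₁ h) (hdfin.insert _), Set.ncard_insert_of_notMem h₂ hdfin, hXe, add_assoc]
    exact hX.add (by decide)

theorem not_iff_or_not_iff {p r : Prop} (h : ¬ (p ↔ r)) (q : Prop) :
    ¬ (p ↔ q) ∨ ¬ (q ↔ r) := by tauto

/-- If the circuit uses `e`, it is rerouted through `w`; otherwise it stays as it is. -/
theorem CircuitIn.subdivide {D : Set β} {N : Set α} (hD : G.CircuitIn D N)
    (he : G.IsLink e x y) (hw : w ∉ V(G)) (hne : e₁ ≠ e₂) (he₁ : e₁ ∉ E(G) \ {e})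
    (he₂ : e₂ ∉ E(G) \ {e}) (hl : ∀ (f : β) (a b : α), H.IsLink f a b ↔
      (f ≠ e ∧ G.IsLink f a b) ∨ (f = e₁ ∧ s(a, b) = s(x, w)) ∨ (f = e₂ ∧ s(a, b) = s(w, y))) :
    ∃ D' N', H.CircuitIn D' N' ∧ N ⊆ N' := by
  have hl₁ : H.IsLink e₁ x w := (hl _ _ _).2 (Or.inr (Or.inl ⟨rfl, rfl⟩))
  have hl₂ : H.IsLink e₂ w y := (hl _ _ _).2 (Or.inr (Or.inr ⟨rfl, rfl⟩))
  have hnew : ∀ {f}, f ≠ e → f ∈ E(G) → f ≠ e₁ ∧ f ≠ e₂ := fun hf hfG =>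
    ⟨fun h => he₁ (h ▸ ⟨hfG, hf⟩), fun h => he₂ (h ▸ ⟨hfG, hf⟩)⟩
  have hlink : ∀ {f}, f ≠ e → f ∈ E(G) → ∀ a b, H.IsLink f a b ↔ G.IsLink f a b := by
    intro f hf hfG a b
    obtain ⟨h1, h2⟩ := hnew hf hfG
    rw [hl]; simp [hf, h1, h2]
  have hcut : ∀ {f}, f ≠ e → f ∈ E(G) → ∀ S, f ∈ H.cutEdges S ↔ f ∈ G.cutEdges S := by
    intro f hf hfG S
    simp only [cutEdges, Set.mem_ofPred_eq, hlink hf hfG]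
  by_cases heD : e ∈ D
  swap
  · have hDe : ∀ f ∈ D, f ≠ e := fun f hf h => heD (h ▸ hf)
    have hcutD : ∀ S, H.cutEdges S ∩ D = G.cutEdges S ∩ D := by
      intro S
      ext f
      simp only [Set.mem_inter_iff, and_congr_left_iff]
      exact fun hf => hcut (hDe f hf) (hD.subset hf) S
    refine ⟨D, N, ⟨fun f hf => ?_, hD.finite, fun f hf a b hab => ?_, fun S => ?_, fun S => ?_⟩,
      subset_rfl⟩
    · obtain ⟨a, b, hab⟩ := exists_isLink_of_mem_edgeSet (hD.subset hf)
      exact ((hlink (hDe f hf) (hD.subset hf) a b).2 hab).edge_mem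
    · exact hD.ends f hf a b ((hlink (hDe f hf) (hD.subset hf) a b).1 hab)
    · rw [hcutD]; exact hD.even S
    · rw [hcutD]; exact hD.conn S
  have hxN : x ∈ N := hD.ends e heD x y he
  have hyN : y ∈ N := hD.ends e heD y x he.symm
  set D' : Set β := insert e₁ (insert e₂ (D \ {e})) with hD'
  have hmem : ∀ S f, f ∈ H.cutEdges S ∩ D' ↔ f ∈ (G.cutEdges S ∩ D) \ {e} ∨
      (f = e₁ ∧ ¬ (x ∈ S ↔ w ∈ S)) ∨ (f = e₂ ∧ ¬ (w ∈ S ↔ y ∈ S)) := by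
    intro S f
    rw [Set.mem_inter_iff, hD', Set.mem_insert_iff, Set.mem_insert_iff]
    constructor
    · rintro ⟨h1, rfl | rfl | ⟨h2, h3⟩⟩
      · exact Or.inr (Or.inl ⟨rfl, (hl₁.mem_cutEdges S).1 h1⟩)
      · exact Or.inr (Or.inr ⟨rfl, (hl₂.mem_cutEdges S).1 h1⟩)
      · exact Or.inl ⟨⟨(hcut h3 (hD.subset h2) S).1 h1, h2⟩, h3⟩
    · rintro (⟨⟨h1, h2⟩, h3⟩ | ⟨rfl, h1⟩ | ⟨rfl, h1⟩)
      · exact ⟨(hcut h3 (hD.subset h2) S).2 h1, Or.inr (Or.inr ⟨h2, h3⟩)⟩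
      · exact ⟨(hl₁.mem_cutEdges S).2 h1, Or.inl rfl⟩
      · exact ⟨(hl₂.mem_cutEdges S).2 h1, Or.inr (Or.inl rfl)⟩
  refine ⟨D', insert w N, ⟨?_, ?_, ?_, ?_, ?_⟩, Set.subset_insert _ _⟩
  · rintro f (rfl | rfl | ⟨hf, hfe⟩)
    · exact hl₁.edge_mem
    · exact hl₂.edge_mem
    · obtain ⟨a, b, hab⟩ := exists_isLink_of_mem_edgeSet (hD.subset hf)
      exact ((hlink hfe (hD.subset hf) a b).2 hab).edge_mem
  · exact ((hD.finite.subset Set.sdiff_subset).insert _).insert _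
  · rintro f (rfl | rfl | ⟨hf, hfe⟩) a b hab
    · rcases hl₁.left_eq_or_eq hab.symm with h1 | h1
      · rcases hab.left_eq_or_eq hl₁ with rfl | rfl
        · exact Or.inr hxN
        · exact Or.inl rfl
      · exact Or.inr (h1 ▸ hxN)
    · rcases hab.left_eq_or_eq hl₂ with rfl | rfl
      · exact Or.inl rfl
      · exact Or.inr hyN
    · exact Or.inr (hD.ends f hf a b ((hlink hfe (hD.subset hf) a b).1 hab))
  · intro S
    refine even_ncard_subdivide (hD.finite.subset Set.inter_subset_right) (hD.even S) ?_
      (fun h => he₁ ⟨hD.subset h.1.2, h.2⟩) (fun h => he₂ ⟨hD.subset h.1.2, h.2⟩) hne (hmem S)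
    rw [Set.mem_inter_iff, he.mem_cutEdges]
    simp [heD]
  · intro S hS hS'
    have hxy : ¬ (x ∈ S ↔ w ∈ S) ∨ ¬ (w ∈ S ↔ y ∈ S) → (H.cutEdges S ∩ D').Nonempty := by
      rintro (h1 | h1)
      · exact ⟨e₁, (hmem S _).2 (Or.inr (Or.inl ⟨rfl, h1⟩))⟩
      · exact ⟨e₂, (hmem S _).2 (Or.inr (Or.inr ⟨rfl, h1⟩))⟩
    -- If `N` lies on one side of `S`, then `w` lies on the other side, and `e₁` is in the cut.
    by_cases hcon : (∃ a ∈ N, a ∈ S) ∧ ∃ a ∈ N, a ∉ S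
    · obtain ⟨f, hf⟩ := hD.conn S hcon.1 hcon.2
      by_cases hfe : f = e
      · apply hxy
        exact not_iff_or_not_iff ((he.mem_cutEdges S).1 (hfe ▸ hf.1)) _
      · exact ⟨f, (hmem S f).2 (Or.inl ⟨hf, hfe⟩)⟩
    · apply hxy
      obtain ⟨a, ha, haS⟩ := hS
      obtain ⟨b, hb, hbS⟩ := hS'
      rcases ha with rfl | ha <;> rcases hb with rfl | hb
      · exact absurd haS hbS
      · left
        have : x ∉ S := fun hxS => hcon ⟨⟨x, hxN, hxS⟩, ⟨b, hb, hbS⟩⟩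
        exact fun h => this (h.2 haS)
      · left
        have : x ∈ S := by by_contra hxS; exact hcon ⟨⟨a, ha, haS⟩, ⟨x, hxN, hxS⟩⟩
        exact fun h => hbS (h.1 this)
      · exact absurd ⟨⟨a, ha, haS⟩, ⟨b, hb, hbS⟩⟩ hcon

/-- The set `B` stays the same. A walk that used `e` now passes through the new vertex `w`, which is
not in `B` and therefore free. -/
theorem NearCircuit.subdivide {m : ℕ} (hG : G.NearCircuit m) (h : G.IsEdgeSubdivision H) :
    H.NearCircuit m := by
  classical
  obtain ⟨e, e₁, e₂, x, y, w, he, hw, hne, he₁, he₂, hV, hl⟩ := h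
  obtain ⟨D, N, B, hD, hB, hdeg, hreach⟩ := hG
  obtain ⟨D', N', hD', hN⟩ := hD.subdivide he hw hne he₁ he₂ hl
  have hl₁ : H.IsLink e₁ x w := (hl _ _ _).2 (Or.inr (Or.inl ⟨rfl, rfl⟩))
  have hl₂ : H.IsLink e₂ w y := (hl _ _ _).2 (Or.inr (Or.inr ⟨rfl, rfl⟩))
  have hxw : x ≠ w := fun h => hw (h ▸ he.left_mem)
  have hyw : y ≠ w := fun h => hw (h ▸ he.right_mem)
  have hwB : w ∉ B := fun h => hw (hB h)
  refine ⟨D', N', B, hD', hB.trans (hV ▸ Set.subset_insert _ _), ?_, ?_⟩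
  · intro z hz hzB
    by_cases hzw : z = w
    · subst hzw
      refine ⟨e₁, e₂, fun f t hf => ?_⟩
      rcases (hl _ _ _).1 hf with ⟨-, h1⟩ | ⟨rfl, h1⟩ | ⟨rfl, h1⟩
      · exact absurd h1.left_mem hw
      · rcases Sym2.eq_iff.1 h1 with ⟨h2, -⟩ | ⟨-, rfl⟩
        · exact absurd h2.symm hxw
        · exact ⟨hxw, Or.inl rfl⟩
      · rcases Sym2.eq_iff.1 h1 with ⟨-, rfl⟩ | ⟨h2, -⟩
        · exact ⟨hyw, Or.inr rfl⟩
        · exact absurd h2.symm hyw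
    · rw [hV] at hz
      have hzG : z ∈ V(G) := hz.resolve_left hzw
      obtain ⟨f₁, f₂, hf⟩ := hdeg z hzG hzB
      -- At `z` the edge `e` is succeeded by whichever of `e₁`, `e₂` is incident with `z`. Since
      -- there is no loop at `z`, only one of them is.
      set g : β → β := fun f => if f = e then (if z = x then e₁ else e₂) else f with hg
      refine ⟨g f₁, g f₂, fun f t hft => ?_⟩
      rcases (hl _ _ _).1 hft with ⟨h0, h1⟩ | ⟨rfl, h1⟩ | ⟨rfl, h1⟩
      · obtain ⟨h2, h3⟩ := hf f t h1
        have h4 : g f = f := if_neg h0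
        exact ⟨h2, h3.imp (fun h => by rw [← h, h4]) (fun h => by rw [← h, h4])⟩
      · rcases Sym2.eq_iff.1 h1 with ⟨rfl, rfl⟩ | ⟨h2, -⟩
        · have h4 : g e = f := by simp [hg]
          exact ⟨Ne.symm hzw, (hf e y he).2.imp (fun h => by rw [← h, h4])
            (fun h => by rw [← h, h4])⟩
        · exact absurd h2 hzw
      · rcases Sym2.eq_iff.1 h1 with ⟨h2, -⟩ | ⟨rfl, rfl⟩
        · exact absurd h2 hzw
        · obtain ⟨h2, h3⟩ := hf e x he.symm
          have h4 : g e = f := by simp [hg, h2.symm]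
          exact ⟨Ne.symm hzw, h3.imp (fun h => by rw [← h, h4]) (fun h => by rw [← h, h4])⟩
  · intro z hz
    obtain ⟨k, hk, hr⟩ := hreach z hz
    refine ⟨k, hk, ?_⟩
    have hadj : ∀ {a b}, G.Adj a b → ∀ {j}, H.WReach B N' a j → H.Adj a b ∨
        ∃ c, H.Adj c b ∧ H.WReach B N' c j := by
      rintro a b ⟨f, hf⟩ j hj
      by_cases hfe : f = e
      · subst hfe
        right
        refine ⟨w, ?_⟩
        rcases hf.eq_and_eq_or_eq_and_eq he with ⟨rfl, rfl⟩ | ⟨rfl, rfl⟩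
        · exact ⟨⟨_, hl₂⟩, hj.free ⟨_, hl₁⟩ hwB⟩
        · exact ⟨⟨_, hl₁.symm⟩, hj.free ⟨_, hl₂.symm⟩ hwB⟩
      · exact Or.inl ⟨f, (hl _ _ _).2 (Or.inl ⟨hfe, hf⟩)⟩
    clear hk hz
    induction hr with
    | start h1 => exact .start (hN h1)
    | free h1 h2 h3 ih =>
      rcases hadj h2 ih with h4 | ⟨c, h4, h5⟩
      · exact ih.free h4 h3
      · exact h5.free h4 h3
    | pay h1 h2 ih =>
      rcases hadj h2 ih with h4 | ⟨c, h4, h5⟩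
      · exact ih.pay h4
      · exact h5.pay h4

end Subdivision

/-! ### Transfer along isomorphisms and subdivisions -/

section Isomorphism

variable {F : Graph α β} {K : Graph α' β'} {φ : V(F) ≃ V(K)} {ψ : E(F) ≃ E(K)}

theorem mem_cutEdges_of_iso (h : ∀ (e : E(F)) (x y : V(F)),
    F.IsLink e x y ↔ K.IsLink (ψ e) (φ x) (φ y)) (S : Set α') (e : E(F)) :
    (ψ e).1 ∈ K.cutEdges S ↔ e.1 ∈ F.cutEdges {x | ∃ hx : x ∈ V(F), (φ ⟨x, hx⟩).1 ∈ S} := by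
  obtain ⟨x, y, hxy⟩ := exists_isLink_of_mem_edgeSet e.2
  have h1 := (h e ⟨x, hxy.left_mem⟩ ⟨y, hxy.right_mem⟩).1 hxy
  rw [h1.mem_cutEdges, hxy.mem_cutEdges]
  simp only [Set.mem_ofPred_eq, hxy.left_mem, hxy.right_mem, exists_true_left]

theorem IsIsomorphic.noBridge (hF : F.NoBridge) (h : F.IsIsomorphic K) : K.NoBridge := by
  obtain ⟨φ, ψ, h⟩ := h
  intro S e he
  obtain ⟨a, ha⟩ := ψ.surjective ⟨e, K.cutEdges_subset S he⟩
  have hae : (ψ a).1 = e := congrArg Subtype.val ha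
  rw [← hae, mem_cutEdges_of_iso h] at he
  obtain ⟨b, hb, hba⟩ := hF _ _ he
  refine ⟨ψ ⟨b, F.cutEdges_subset _ hb⟩, (mem_cutEdges_of_iso h S _).2 hb, fun hcon => hba ?_⟩
  rw [← hae] at hcon
  exact congrArg Subtype.val (ψ.injective (Subtype.ext hcon))

theorem CircuitIn.of_iso {D : Set β} {N : Set α} (hD : F.CircuitIn D N)
    (h : ∀ (e : E(F)) (x y : V(F)), F.IsLink e x y ↔ K.IsLink (ψ e) (φ x) (φ y)) :
    K.CircuitIn {e' | ∃ e : E(F), e.1 ∈ D ∧ (ψ e).1 = e'}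
      {y | ∃ x : V(F), x.1 ∈ N ∧ (φ x).1 = y} where
  subset := by rintro _ ⟨e, -, rfl⟩; exact (ψ e).2
  finite := by
    have : {e' | ∃ e : E(F), e.1 ∈ D ∧ (ψ e).1 = e'} =
        (fun e => (ψ e).1) '' ((fun e : E(F) => e.1) ⁻¹' D) := by
      ext; simp
    rw [this]
    exact (hD.finite.preimage (Subtype.val_injective.injOn)).image _
  ends := by
    rintro _ ⟨e, he, rfl⟩ x' y' hxy'
    obtain ⟨x, hx⟩ := φ.surjective ⟨x', hxy'.left_mem⟩
    obtain ⟨y, hy⟩ := φ.surjective ⟨y', hxy'.right_mem⟩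
    have hx' : (φ x).1 = x' := congrArg Subtype.val hx
    have hy' : (φ y).1 = y' := congrArg Subtype.val hy
    subst hx' hy'
    exact ⟨x, hD.ends e he x y ((h e x y).2 hxy'), rfl⟩
  even S := by
    convert hD.even {x | ∃ hx : x ∈ V(F), (φ ⟨x, hx⟩).1 ∈ S} using 1
    symm
    apply Set.ncard_congr (fun a ha => (ψ ⟨a, F.cutEdges_subset _ ha.1⟩).1)
    · intro a ha
      exact ⟨(mem_cutEdges_of_iso h S ⟨a, F.cutEdges_subset _ ha.1⟩).2 ha.1, _, ha.2, rfl⟩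
    · intro a b ha hb hab
      exact congrArg Subtype.val (ψ.injective (Subtype.ext hab))
    · rintro _ ⟨h1, e, he, rfl⟩
      exact ⟨e, ⟨(mem_cutEdges_of_iso h S e).1 h1, he⟩, rfl⟩
  conn S := by
    rintro ⟨_, ⟨x, hx, rfl⟩, hxS⟩ ⟨_, ⟨y, hy, rfl⟩, hyS⟩
    obtain ⟨e, he, heD⟩ := hD.conn {x | ∃ hx : x ∈ V(F), (φ ⟨x, hx⟩).1 ∈ S}
      ⟨x, hx, x.2, hxS⟩ ⟨y, hy, fun ⟨_, hcon⟩ => hyS hcon⟩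
    exact ⟨_, (mem_cutEdges_of_iso h S ⟨e, F.cutEdges_subset _ he⟩).2 he, _, heD, rfl⟩

/-- With `B` the whole vertex set every step costs one, so the cost of a walk is its length and the
bound is the one on distances. -/
theorem IsIsomorphic.nearCircuit {m : ℕ} (hF : F.hamDefect < m) (h : F.IsIsomorphic K) :
    K.NearCircuit m := by
  obtain ⟨φ, ψ, h⟩ := h
  simp only [hamDefect, iInf_lt_iff] at hF
  obtain ⟨C, ⟨hCF, hC⟩, hlt⟩ := hF
  refine ⟨_, _, V(K), (hC.circuitIn hCF).of_iso h, subset_rfl,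
    fun x hx hx' => absurd hx hx', fun x' hx' => ?_⟩
  obtain ⟨x, hx⟩ := φ.surjective ⟨x', hx'⟩
  have hx'' : (φ x).1 = x' := congrArg Subtype.val hx
  subst hx''
  have hd : F.distTo C x < m := (le_iSup (fun x => F.distTo C x) x).trans_lt hlt
  simp only [distTo, iInf_lt_iff] at hd
  obtain ⟨y, hy, hyx⟩ := hd
  obtain ⟨p, hp⟩ := SimpleGraph.exists_walk_of_edist_ne_top (ne_top_of_lt hyx)
  rw [← hp] at hyx
  have key : ∀ {a b : V(F)} (p : F.toSimpleGraph.Walk a b) (j : ℕ) (N : Set α'),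
      K.WReach V(K) N (φ a).1 j → K.WReach V(K) N (φ b).1 (j + p.length) := by
    intro a b p
    induction p with
    | nil => intro j N hj; exact hj
    | @cons a b c hadj p ih =>
      intro j N hj
      obtain ⟨e, he⟩ := hadj.2
      have := ih (j + 1) N (hj.pay ⟨_, (h ⟨e, he.edge_mem⟩ a b).1 he⟩)
      rw [SimpleGraph.Walk.length_cons]
      convert this using 1
      omega
  refine ⟨0 + p.length, ?_, key p 0 _ (.start ⟨y, hy, rfl⟩)⟩
  rw [zero_add]
  exact_mod_cast hyx

theorem IsSubdivision.noBridge (hF : F.NoBridge) (h : F.IsSubdivision K) : K.NoBridge := by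
  induction h with
  | of_iso h => exact h.noBridge hF
  | subdivide _ h ih => exact ih.subdivide h

theorem IsSubdivision.nearCircuit {m : ℕ} (hF : F.hamDefect < m) (h : F.IsSubdivision K) :
    K.NearCircuit m := by
  induction h with
  | of_iso h => exact h.nearCircuit hF
  | subdivide _ h ih => exact ih.subdivide h

end Isomorphism

/-! ### Components -/

theorem isComponentOf_induce {H : Graph α β} {x : α} (hx : x ∈ V(H)) :
    (H.induce {y | Relation.ReflTransGen H.Adj x y}).IsComponentOf H := by
  set X := {y | Relation.ReflTransGen H.Adj x y} with hX
  have hXV : X ⊆ V(H) := by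
    intro y hy
    rcases Relation.ReflTransGen.cases_tail hy with rfl | ⟨z, -, hz⟩
    · exact hx
    · exact hz.right_mem
  have hstep : ∀ S : Set α, x ∈ S → ∀ y ∈ X, y ∉ S → ((H.induce X).cutEdges S).Nonempty := by
    intro S hxS y hy
    induction hy with
    | refl => intro h; exact absurd hxS h
    | @tail b c hb hbc ih =>
      intro hc
      by_cases hbS : b ∈ S
      · obtain ⟨e, he⟩ := hbc
        exact ⟨e, b, c, ⟨he, hb, hb.tail ⟨e, he⟩⟩, hbS, hc⟩
      · exact ih hbS
  refine ⟨⟨induce_le hXV, isConnectedGraph_of_cutEdges_nonempty ⟨x, .refl⟩ ?_⟩, ?_⟩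
  · intro S a b ha hb haS hbS
    by_cases hxS : x ∈ S
    · exact hstep S hxS b hb hbS
    · rw [← cutEdges_compl]
      exact hstep Sᶜ hxS a ha (by simpa using haS)
  · rintro L ⟨hLH, hL⟩ hKL
    have hsub : V(L) ⊆ X := by
      intro y hy
      by_contra hyX
      obtain ⟨e, a, b, hab, ha, hb⟩ := hL.cutEdges_nonempty (S := X) (x := x)
        (hKL.vertexSet_mono (by exact Relation.ReflTransGen.refl)) hy .refl hyX
      exact hb (Relation.ReflTransGen.tail ha ⟨e, hab.mono hLH⟩)
    exact ⟨hsub, fun e a b hab => ⟨hab.mono hLH, hsub hab.left_mem, hsub hab.right_mem⟩⟩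

theorem IsConnectedGraph.isComponentOf_self {H : Graph α β} (hH : H.IsConnectedGraph) :
    H.IsComponentOf H :=
  ⟨⟨le_refl _, hH⟩, fun _ hL _ => hL.1⟩

/-- If all components of a finite graph are even, then every set of vertices that no edge leaves
is even. -/
theorem even_ncard_of_cutEdges_eq_empty {H : Graph α β} (hfin : V(H).Finite)
    (heven : ∀ K : Graph α β, K.IsComponentOf H → Even V(K).ncard) :
    ∀ (n : ℕ) (S : Set α), S.ncard = n → S ⊆ V(H) → H.cutEdges S = ∅ → Even S.ncard := by
  intro n
  induction n using Nat.strong_induction_on with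
  | _ n ih =>
    rintro S rfl hSV hcut
    rcases S.eq_empty_or_nonempty with rfl | ⟨x, hx⟩
    · simp
    have hSfin : S.Finite := hfin.subset hSV
    set X := {y | Relation.ReflTransGen H.Adj x y} with hX
    have hXS : X ⊆ S := by
      intro y hy
      induction hy with
      | refl => exact hx
      | @tail b c hb hbc ihb =>
        obtain ⟨e, he⟩ := hbc
        by_contra hc
        exact Set.eq_empty_iff_forall_notMem.1 hcut e ⟨b, c, he, ihb, hc⟩
    have hxX : x ∈ X := Relation.ReflTransGen.refl
    -- Split off the component of `x`. It is even, and the rest of `S` is still left by no edge.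
    have hXeven : Even X.ncard := heven _ (isComponentOf_induce (hSV hx))
    have hcard := Set.ncard_sdiff_add_ncard_of_subset hXS hSfin
    have hpos : 0 < X.ncard := (Set.ncard_pos (hSfin.subset hXS)).2 ⟨x, hxX⟩
    have h1 := ih (S \ X).ncard (by omega) (S \ X) rfl (Set.sdiff_subset.trans hSV) (by
      rw [Set.eq_empty_iff_forall_notMem]
      rintro e ⟨a, b, hab, ha, hb⟩
      by_cases hbS : b ∈ S
      · have hbX : b ∈ X := by by_contra h; exact hb ⟨hbS, h⟩
        exact ha.2 (Relation.ReflTransGen.tail hbX ⟨e, hab.symm⟩)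
      · exact Set.eq_empty_iff_forall_notMem.1 hcut e ⟨a, b, hab, ha.1, hbS⟩)
    rw [← hcard]
    exact h1.add hXeven

/-! ### Spanning subgraphs of the iterated Petersen graphs -/

section Spanning

variable {n : ℕ} {H : Graph (IterVertex n) (Sym2 (IterVertex n))}

/-- The edge ends of a spanning subgraph. -/
def edgeEnds (H : Graph (IterVertex n) (Sym2 (IterVertex n))) (d : IterVertex n × Fin 3) : Prop :=
  H.IsLink s(d.1, (iterRot n d).1) d.1 (iterRot n d).1

theorem exists_edgeEnd (hH : H ≤ iteratedPetersen n) {e : Sym2 (IterVertex n)}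
    {x y : IterVertex n} (h : H.IsLink e x y) :
    ∃ i, (iterRot n (x, i)).1 = y ∧ e = s(x, (iterRot n (x, i)).1) ∧ edgeEnds H (x, i) := by
  obtain ⟨he, i, hi⟩ := iteratedPetersen_isLink.1 (h.mono hH)
  refine ⟨i, hi, by rw [hi, he], ?_⟩
  unfold edgeEnds
  rw [hi]
  exact he ▸ h

theorem edgeEnds_symm (d : IterVertex n × Fin 3) :
    edgeEnds H (iterRot n d) ↔ edgeEnds H d := by
  unfold edgeEnds
  rw [(isRot_iterRot n).invol, Sym2.eq_swap, isLink_comm]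

theorem crosses_iff_mem_cutEdges (hH : H ≤ iteratedPetersen n) (T : Set (IterVertex n))
    (e : Sym2 (IterVertex n)) : e ∈ H.cutEdges T ↔
      ∃ d, Crosses (iterRot n) (edgeEnds H) T d ∧ e = s(d.1, (iterRot n d).1) := by
  constructor
  · rintro ⟨x, y, hxy, hx, hy⟩
    obtain ⟨i, rfl, rfl, hi⟩ := exists_edgeEnd hH hxy
    exact ⟨(x, i), ⟨hi, hx, hy⟩, rfl⟩
  · rintro ⟨d, ⟨h1, h2, h3⟩, rfl⟩
    exact ⟨_, _, h1, h2, h3⟩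

/-- A bridge of `H` would be a bridge of its component, and a set left by no edge is a union of even
components. -/
theorem cutGood_edgeEnds (hH : H ≤ iteratedPetersen n) (hV : V(H) = Set.univ)
    (hK : ∀ K : Graph (IterVertex n) (Sym2 (IterVertex n)), K.IsComponentOf H →
      K.NoBridge ∧ Even V(K).ncard) : CutGood (iterRot n) (edgeEnds H) where
  symm := edgeEnds_symm
  two T d hd := by
    have hx : d.1 ∈ V(H) := hd.1.left_mem
    set X := {y | Relation.ReflTransGen H.Adj d.1 y} with hX
    obtain ⟨e', ⟨x', y', hl, hx', hy'⟩, hne⟩ := (hK _ (isComponentOf_induce hx)).1 T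
      s(d.1, (iterRot n d).1)
      ⟨d.1, _, ⟨hd.1, Relation.ReflTransGen.refl, Relation.ReflTransGen.single ⟨_, hd.1⟩⟩,
        hd.2.1, hd.2.2⟩
    obtain ⟨i, hi, he, hend⟩ := exists_edgeEnd hH hl.1
    refine ⟨(x', i), fun h => hne ?_, hend, hx', ?_⟩
    · rw [he, ← h]
    · rw [hi]; exact hy'
  odd T hT := by
    by_contra! hcon
    refine Nat.not_even_iff_odd.2 hT (even_ncard_of_cutEdges_eq_empty (hV ▸ Set.toFinite _)
      (fun K h => (hK K h).2) _ T rfl (hV ▸ Set.subset_univ _) ?_)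
    rw [Set.eq_empty_iff_forall_notMem]
    intro e he
    obtain ⟨d, hd, -⟩ := (crosses_iff_mem_cutEdges hH T e).1 he
    exact hcon d hd

theorem CutGood.isConnectedGraph (hV : V(H) = Set.univ)
    (hc : CutGood (iterRot n) (edgeEnds H)) : H.IsConnectedGraph := by
  have hne : Nonempty (IterVertex n) :=
    (Nat.card_pos_iff.1 (by rw [card_iterVertex]; positivity)).1
  refine isConnectedGraph_of_cutEdges_nonempty (hV ▸ Set.univ_nonempty) ?_
  intro S x y _ _ hxS hyS
  rw [Set.nonempty_iff_ne_empty]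
  intro hcut
  have hcl : IsClosedFor (iterRot n) (edgeEnds H) S := by
    rw [isClosedFor_iff (isRot_iterRot n).invol edgeEnds_symm]
    rintro d ⟨h1, h2, h3⟩
    exact Set.eq_empty_iff_forall_notMem.1 hcut _ ⟨_, _, h1, h2, h3⟩
  rcases hc.connected n hcl with rfl | rfl
  · exact hxS
  · exact hyS (Set.mem_univ y)

/-- Each edge of a cut has exactly one end in `T`, so crossing edge ends correspond bijectively to
cut edges. -/
theorem CircuitIn.circuitLike (hH : H ≤ iteratedPetersen n) {D : Set (Sym2 (IterVertex n))}
    {N : Set (IterVertex n)} (hD : H.CircuitIn D N) :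
    CircuitLike (iterRot n) (fun d => edgeEnds H d ∧ s(d.1, (iterRot n d).1) ∈ D) N where
  symm d := by
    rw [edgeEnds_symm, (isRot_iterRot n).invol, Sym2.eq_swap]
  even T := by
    convert hD.even T using 1
    apply Set.ncard_congr (fun d _ => s(d.1, (iterRot n d).1))
    · rintro d ⟨⟨h1, h2⟩, h3, h4⟩
      exact ⟨⟨_, _, h1, h3, h4⟩, h2⟩
    · rintro ⟨x, i⟩ ⟨y, j⟩ ⟨-, h3, h4⟩ ⟨-, h5, h6⟩ hab
      rcases Sym2.eq_iff.1 hab with ⟨h7, h8⟩ | ⟨h7, h8⟩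
      · obtain rfl : x = y := h7
        rw [(isRot_iterRot n).simple x i j h8]
      · exact absurd h3 (by dsimp only at h7 ⊢; rw [h7]; exact h6)
    · rintro e ⟨h1, h2⟩
      obtain ⟨d, ⟨h3, h4, h5⟩, rfl⟩ := (crosses_iff_mem_cutEdges hH T e).1 h1
      exact ⟨d, ⟨⟨h3, h2⟩, h4, h5⟩, rfl⟩
  conn T h1 h2 := by
    obtain ⟨e, h3, h4⟩ := hD.conn T h1 h2
    obtain ⟨d, ⟨h5, h6, h7⟩, rfl⟩ := (crosses_iff_mem_cutEdges hH T e).1 h3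
    exact ⟨d, ⟨h5, h4⟩, h6, h7⟩

theorem WReach.exists_reachFrom (hH : H ≤ iteratedPetersen n) {B N : Set (IterVertex n)}
    (hB : ∀ x, IsBranch (edgeEnds H) x → x ∈ B) {x : IterVertex n} {k : ℕ}
    (h : H.WReach B N x k) : ∃ k' ≤ k, ReachFrom (iterRot n) (edgeEnds H) N x k' := by
  induction h with
  | start hx => exact ⟨0, le_rfl, .start hx⟩
  | free _ hadj hy ih =>
    obtain ⟨k', hk', hr⟩ := ih
    obtain ⟨e, he⟩ := hadj
    obtain ⟨i, rfl, -, hi⟩ := exists_edgeEnd hH he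
    have := hr.step i hi
    rw [branchCost_eq_zero.2 (fun h => hy (hB _ h))] at this
    exact ⟨k', hk', this⟩
  | pay _ hadj ih =>
    obtain ⟨k', hk', hr⟩ := ih
    obtain ⟨e, he⟩ := hadj
    obtain ⟨i, rfl, -, hi⟩ := exists_edgeEnd hH he
    refine ⟨_, ?_, hr.step i hi⟩
    unfold branchCost
    split <;> omega

theorem NearCircuit.le (hn : 2 ≤ n) (hH : H ≤ iteratedPetersen n) (hV : V(H) = Set.univ)
    (hc : CutGood (iterRot n) (edgeEnds H)) {m : ℕ} (hm : H.NearCircuit m) :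
    2 ^ (2 * n - 3) < m := by
  obtain ⟨D, N, B, hD, -, hdeg, hreach⟩ := hm
  -- Outside `B` at most two edges are present at a vertex, whereas a branch vertex has three
  -- distinct ones.
  have hB : ∀ x, IsBranch (edgeEnds H) x → x ∈ B := by
    intro x hx
    by_contra hxB
    obtain ⟨f₁, f₂, hf⟩ := hdeg x (hV ▸ Set.mem_univ x) hxB
    have hinj : ∀ i j, s(x, (iterRot n (x, i)).1) = s(x, (iterRot n (x, j)).1) → i = j :=
      fun i j hij => (isRot_iterRot n).simple x i j (Sym2.congr_right.1 hij)
    have h0 := (hf _ _ (hx 0)).2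
    have h1 := (hf _ _ (hx 1)).2
    have h2 := (hf _ _ (hx 2)).2
    rcases h0 with a | a <;> rcases h1 with b | b <;> rcases h2 with c | c <;>
    first
    | exact absurd (hinj _ _ (a.trans b.symm)) (by decide)
    | exact absurd (hinj _ _ (a.trans c.symm)) (by decide)
    | exact absurd (hinj _ _ (b.trans c.symm)) (by decide)
  obtain ⟨x, hxb, hx⟩ := hc.exists_far_branch hn (hD.circuitLike hH)
  obtain ⟨k, hk, hr⟩ := hreach x (hB x hxb)
  obtain ⟨k', hk', hr'⟩ := hr.exists_reachFrom hH hB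
  have := hx k' hr'
  omega

end Spanning

/-! ### Conclusion -/

theorem hamDefect_le_maxHamDefect {S : Set (Graph α β)} (hS : maxHamDefect S ≠ ⊤) {F : Graph α β}
    (hF : F ∈ S) : F.hamDefect ≤ maxHamDefect S := by
  unfold maxHamDefect at hS ⊢
  split at hS
  · rw [if_pos ‹_›]
    exact le_sSup ⟨F, hF, rfl⟩
  · exact absurd rfl hS

/-- The components are used twice: all of them together yield `CutGood` and so connectedness of `H`;
then `H` is itself a component and a subdivision of one `F`, whose small defect contradicts
`NearCircuit.le`. -/
theorem not_isEvenSubdivisionFactor {S : Set (Graph α β)} (hS : ∀ F ∈ S, F.IsTwoConnected)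
    {k : ℕ} (hk : 2 ≤ k) (hlt : ∀ F ∈ S, F.hamDefect < ((2 ^ (2 * k - 3) : ℕ) : ℕ∞)) :
    ¬ IsEvenSubdivisionFactor S (iteratedPetersen k) := by
  rintro ⟨H, hH, hV, hK⟩
  rw [vertexSet_iteratedPetersen] at hV
  have hc : CutGood (iterRot k) (edgeEnds H) := cutGood_edgeEnds hH hV fun K h => by
    obtain ⟨⟨F, hF, hFK⟩, -, heven⟩ := hK K h
    exact ⟨hFK.noBridge (hS F hF).noBridge, heven⟩
  obtain ⟨⟨F, hF, hFH⟩, -⟩ := hK H (hc.isConnectedGraph hV).isComponentOf_self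
  exact lt_irrefl _ ((hFH.nearCircuit (hlt F hF)).le hk hH hV hc)

theorem infinite_setOf_lt_two_pow {m : ℕ∞} (hm : m ≠ ⊤) :
    {k : ℕ | 2 ≤ k ∧ m < ((2 ^ (2 * k - 3) : ℕ) : ℕ∞)}.Infinite := by
  lift m to ℕ using hm
  -- The witness exceeds `a`, and its exponent `2 * (a + m + 3) - 3` is at least `m`.
  refine Set.infinite_of_forall_exists_gt fun a => ⟨a + m + 3, ⟨by omega, ?_⟩, by omega⟩
  have h1 : m < 2 ^ m := Nat.lt_two_pow_self
  have h2 : 2 ^ m ≤ 2 ^ (2 * (a + m + 3) - 3) := Nat.pow_le_pow_right (by decide) (by omega)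
  exact_mod_cast h1.trans_le h2

end Graph

end

theorem mainTheorem4 {α β : Type*} (S₀ : Set (Graph α β))
    (hS₀ : ∀ F ∈ S₀, F.IsFiniteGraph ∧ F.IsTwoConnected)
    (hl : Graph.maxHamDefect S₀ ≠ ⊤) :
    {k : ℕ | 2 ≤ k ∧ Graph.maxHamDefect S₀ < ((2 ^ (2 * k - 3) : ℕ) : ℕ∞)}.Infinite ∧
    (∀ j k : ℕ, j ≠ k →
      ¬ (Graph.iteratedPetersen j).IsIsomorphic (Graph.iteratedPetersen k)) ∧
    ∀ k : ℕ, 2 ≤ k → Graph.maxHamDefect S₀ < ((2 ^ (2 * k - 3) : ℕ) : ℕ∞) →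
      (Graph.iteratedPetersen k).IsFiniteGraph ∧
      (Graph.iteratedPetersen k).IsThreeConnected ∧
      (Graph.iteratedPetersen k).IsCubic ∧
      ¬ Graph.IsEvenSubdivisionFactor S₀ (Graph.iteratedPetersen k) :=
  ⟨Graph.infinite_setOf_lt_two_pow hl, fun _ _ hjk => Graph.not_isIsomorphic_iteratedPetersen hjk,
    fun k hk hlt => ⟨Graph.isFiniteGraph_iteratedPetersen k,
      Graph.isThreeConnected_iteratedPetersen k, Graph.isCubic_iteratedPetersen k,
      Graph.not_isEvenSubdivisionFactor (fun F hF => (hS₀ F hF).2) hk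
        fun _ hF => (Graph.hamDefect_le_maxHamDefect hl hF).trans_lt hlt⟩⟩
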